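/- Consider $N$ agents with disturbance-free uncertain linear dynamics $$\dot x_i=A_i(\mu)x_i+B_i(\mu)u_i,\qquad y_i=C_i(\mu)x_i,\qquad i=1,\dots,N,$$ with $x_i\in\mathbb R^{n_i}$, $u_i\in\mathbb R^{m_i}$, $y_i\in\mathbb R^{p_i}$, where $A_i(\mu)=A_i+\Delta A_i$, $B_i(\mu)=B_i+\Delta B_i$, $C_i(\mu)=C_i+\Delta C_i$, the nominal matrices $A_i,B_i,C_i$ are known, and $\mu=(\Delta A_i,\Delta B_i,\Delta C_i)_{i}$ is the uncertainty. Agent $i$ has the cost $$J_i(y)=y_i^{\top}R_{ii}y_i+Q_{ii}y_i+q_i+\sum_{j\ne i}\bigl(y_i^{\top}R_{ij}y_j+y_j^{\top}Q_{ij}y_j\bigr),$$ where $Q_{ii}$ is a row vector, $q_i\in\mathbb R$, $R_{ii}$ is a (not necessarily symmetric) positive definite matrix, and, for $j\neq i$, $R_{ij}\ne0$ and $Q_{ij}\neq 0$ if $j$ belongs to the neighbour set $\mathcal N_i\subseteq\{1,\dots,N\}\setminus\{i\}$, while $R_{ij}=0$ and $Q_{ij}=0$ otherwise. No connectedness or other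 condition is imposed on the graph given by the sets $\mathcal N_i$. Let $\bar R$ be the block matrix with diagonal blocks $R_{ii}+R_{ii}^{\top}$ and off-diagonal blocks $R_{ij}$, let $\bar Q=\operatorname{col}(Q_{11}^{\top},\dots,Q_{NN}^{\top})$, and let $e_i=\nabla_iJ_i(y)=(R_{ii}+R_{ii}^{\top})y_i+\sum_{j\in\mathcal N_i}R_{ij}y_j+Q_{ii}^{\top}$ be the partial gradient of $J_i$ in $y_i$. A Nash equilibrium (NE) is a $y^*$ such that, for every $i$, $y_i^*$ minimizes $J_i$ over $\mathbb R^{p_i}$ when the other components of $y^*$ are fixed. Assume that $\bar R$ is positive definite ($y^{\top}\bar Ry>0$ for all $y\neq0$), and that for every $i$ the pair $(A_i,B_i)$ is stabilizable, the pair $(A_i,C_i)$ is detectable, and $$\operatorname{rank}\begin{bmatrix}A_i&B_i\\ C_i&0\end{bmatrix}=n_i+p_i .$$ Then the game has exactly one NE $y^*$, it satisfies $\bar Ry^*+\bar Q=0$, and there exist matrices $L_i,K_{i1},K_{i2}$ ($i=1,\dots,N$), with all $A_i-L_i(R_{ii}+R_{ii}^{\top})C_i$ Hurwitz, such that the distributed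 strategy $$\dot\xi_i=A_i\xi_i+B_iu_i-L_i(\hat e_i-e_i),\qquad \dot\zeta_i=e_i,\qquad u_i=K_{i1}\xi_i+K_{i2}\zeta_i,$$ $$\hat e_i=(R_{ii}+R_{ii}^{\top})C_i\xi_i+\sum_{j\in\mathcal N_i}R_{ij}C_j\xi_j,$$ in which neighbours exchange $y_i$ and $C_i\xi_i$, solves the NE seeking problem: for all $\mu$ in some open neighbourhood of $\mu=0$, (i) the closed-loop system with state $(x_i,\xi_i,\zeta_i)_{i}$ has a globally exponentially stable equilibrium, and (ii) along every closed-loop trajectory $y(t)\to y^*$ as $t\to\infty$. -/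

import Mathlib

open Matrix Set Filter Topology

/-- A real square matrix is Hurwitz if all its complex eigenvalues have negative real part. -/
def IsHurwitz {k : ℕ} (M : Matrix (Fin k) (Fin k) ℝ) : Prop :=
  ∀ z ∈ spectrum ℂ (M.map (fun r : ℝ => (r : ℂ))), z.re < 0

/-- `(A, B)` is stabilizable: some state feedback makes `A + B K` Hurwitz. -/
def IsStabilizable {n m : ℕ} (A : Matrix (Fin n) (Fin n) ℝ) (B : Matrix (Fin n) (Fin m) ℝ) :
    Prop :=
  ∃ K : Matrix (Fin m) (Fin n) ℝ, IsHurwitz (A + B * K)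

/-- `(A, C)` is detectable: some output injection makes `A - L C` Hurwitz. -/
def IsDetectable {n p : ℕ} (A : Matrix (Fin n) (Fin n) ℝ) (C : Matrix (Fin p) (Fin n) ℝ) :
    Prop :=
  ∃ L : Matrix (Fin n) (Fin p) ℝ, IsHurwitz (A - L * C)

/-- The data of the linear-quadratic network game of `N` agents; the decision variable of
agent `i` ranges over `ℝ^(p i)`. The matrices `R i j` and `Q i j` (`j ≠ i`) are nonzero exactly
for neighbours. The row vector `Q_ii` is `b i`, the constant term `q_i` is `c i`; the entries
`Q i i` are not used. `R i i` is positive definite, but not necessarily symmetric. -/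
structure NetworkGame (N : ℕ) (p : Fin N → ℕ) where
  R : ∀ i j : Fin N, Matrix (Fin (p i)) (Fin (p j)) ℝ
  Q : ∀ _i j : Fin N, Matrix (Fin (p j)) (Fin (p j)) ℝ
  b : ∀ i : Fin N, Fin (p i) → ℝ
  c : Fin N → ℝ
  nbr : Fin N → Finset (Fin N)
  self_notMem : ∀ i, i ∉ nbr i
  ne_zero_of_mem : ∀ i, ∀ j ∈ nbr i, R i j ≠ 0 ∧ Q i j ≠ 0
  eq_zero_of_notMem : ∀ i j, j ≠ i → j ∉ nbr i → R i j = 0 ∧ Q i j = 0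
  diag_pos : ∀ i, ∀ v : Fin (p i) → ℝ, v ≠ 0 → 0 < v ⬝ᵥ (R i i *ᵥ v)

namespace NetworkGame

variable {N : ℕ} {p : Fin N → ℕ}

/-- The cost function `J_i` of agent `i`. -/
def cost (G : NetworkGame N p) (i : Fin N) (y : ∀ i, Fin (p i) → ℝ) : ℝ :=
  y i ⬝ᵥ (G.R i i *ᵥ y i) + G.b i ⬝ᵥ y i + G.c i
    + ∑ j ∈ Finset.univ.erase i, (y i ⬝ᵥ (G.R i j *ᵥ y j) + y j ⬝ᵥ (G.Q i j *ᵥ y j))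

/-- `y` is a Nash equilibrium: no agent can lower its cost by changing its own decision. -/
def IsNE (G : NetworkGame N p) (y : ∀ i, Fin (p i) → ℝ) : Prop :=
  ∀ i, ∀ v : Fin (p i) → ℝ, G.cost i y ≤ G.cost i (Function.update y i v)

/-- The linear part of the partial gradient of the cost of agent `i`:
`(R_ii + R_iiᵀ) y_i + ∑_{j ∈ N_i} R_ij y_j`. -/
def linGrad (G : NetworkGame N p) (i : Fin N) (y : ∀ i, Fin (p i) → ℝ) : Fin (p i) → ℝ :=
  (G.R i i + (G.R i i)ᵀ) *ᵥ y i + ∑ j ∈ G.nbr i, G.R i j *ᵥ y j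

/-- The local partial gradient `e_i = ∇_i J_i (y_i, y_{N_i})`, see `hasDerivAt_cost`. -/
def partialGrad (G : NetworkGame N p) (i : Fin N) (y : ∀ i, Fin (p i) → ℝ) : Fin (p i) → ℝ :=
  G.linGrad i y + G.b i

/-- The block matrix `R̄`: diagonal blocks `R_ii + R_iiᵀ`, off-diagonal blocks `R_ij`. -/
def Rbar (G : NetworkGame N p) : Matrix (Σ i, Fin (p i)) (Σ i, Fin (p i)) ℝ :=
  fun k l => G.R k.1 l.1 k.2 l.2 + if k.1 = l.1 then G.R l.1 k.1 l.2 k.2 else 0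

/-- The stacked vector `Q̄ = col(Q_11ᵀ, …, Q_NNᵀ)`. -/
def Qbar (G : NetworkGame N p) : (Σ i, Fin (p i)) → ℝ :=
  fun k => G.b k.1 k.2

/-- Strict monotonicity: the (not necessarily symmetric) matrix `R̄` is positive definite. -/
def IsMonotone (G : NetworkGame N p) : Prop :=
  ∀ y : (Σ i, Fin (p i)) → ℝ, y ≠ 0 → 0 < y ⬝ᵥ (G.Rbar *ᵥ y)

/-- `partialGrad` is the gradient of the cost of agent `i` in its own decision variable. -/
theorem hasDerivAt_cost (G : NetworkGame N p) (i : Fin N) (y : ∀ i, Fin (p i) → ℝ)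
    (h : Fin (p i) → ℝ) :
    HasDerivAt (fun t : ℝ => G.cost i (Function.update y i (y i + t • h)))
      (G.partialGrad i y ⬝ᵥ h) 0 := by
  have hsub : G.nbr i ⊆ Finset.univ.erase i := fun j hj =>
    Finset.mem_erase.2 ⟨fun e => G.self_notMem i (e ▸ hj), Finset.mem_univ j⟩
  have hs : ∑ j ∈ G.nbr i, G.R i j *ᵥ y j = ∑ j ∈ Finset.univ.erase i, G.R i j *ᵥ y j :=
    Finset.sum_subset hsub fun j hj hn => by
      rw [(G.eq_zero_of_notMem i j (Finset.ne_of_mem_erase hj) hn).1, zero_mulVec]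
  have key : ∀ t : ℝ, G.cost i (Function.update y i (y i + t • h)) =
      G.cost i y + t * (G.partialGrad i y ⬝ᵥ h) + t ^ 2 * (h ⬝ᵥ (G.R i i *ᵥ h)) := by
    intro t
    have h1 : ∑ j ∈ Finset.univ.erase i,
          ((y i + t • h) ⬝ᵥ (G.R i j *ᵥ Function.update y i (y i + t • h) j)
            + Function.update y i (y i + t • h) j ⬝ᵥ
              (G.Q i j *ᵥ Function.update y i (y i + t • h) j)) =
        ∑ j ∈ Finset.univ.erase i, (y i ⬝ᵥ (G.R i j *ᵥ y j) + y j ⬝ᵥ (G.Q i j *ᵥ y j))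
          + t * (∑ j ∈ Finset.univ.erase i, h ⬝ᵥ (G.R i j *ᵥ y j)) := by
      rw [Finset.mul_sum, ← Finset.sum_add_distrib]
      refine Finset.sum_congr rfl fun j hj => ?_
      rw [Function.update_of_ne (Finset.ne_of_mem_erase hj), add_dotProduct, smul_dotProduct,
        smul_eq_mul]
      ring
    have h2 : G.partialGrad i y ⬝ᵥ h = h ⬝ᵥ (G.R i i *ᵥ y i) + y i ⬝ᵥ (G.R i i *ᵥ h)
        + (∑ j ∈ Finset.univ.erase i, h ⬝ᵥ (G.R i j *ᵥ y j)) + G.b i ⬝ᵥ h := by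
      unfold partialGrad linGrad
      rw [hs, add_dotProduct, dotProduct_comm _ h, dotProduct_add, dotProduct_sum, add_mulVec,
        dotProduct_add, mulVec_transpose, dotProduct_comm h (y i ᵥ* _), dotProduct_mulVec (y i)]
    rw [h2]
    simp only [cost, Function.update_self, h1]
    simp only [mulVec_add, mulVec_smul, add_dotProduct, dotProduct_add, smul_dotProduct,
      dotProduct_smul, smul_eq_mul]
    ring
  have hd : HasDerivAt (fun t : ℝ => G.cost i y + t * (G.partialGrad i y ⬝ᵥ h)
      + t ^ 2 * (h ⬝ᵥ (G.R i i *ᵥ h))) (G.partialGrad i y ⬝ᵥ h) 0 := by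
    have := (((hasDerivAt_id (0 : ℝ)).mul_const (G.partialGrad i y ⬝ᵥ h)).const_add
      (G.cost i y)).fun_add (((hasDerivAt_id (0 : ℝ)).fun_pow 2).mul_const (h ⬝ᵥ (G.R i i *ᵥ h)))
    simpa using this
  exact hd.congr_of_eventuallyEq (Eventually.of_forall key)

end NetworkGame

/-- The uncertainty `μ`: the tuple `(ΔA, ΔB, ΔC)` of the uncertain parts of all agents, with its
usual (finite-dimensional) topology. -/
abbrev Uncertainty (N : ℕ) (n m p : Fin N → ℕ) : Type :=
  (∀ i, Matrix (Fin (n i)) (Fin (n i)) ℝ) × (∀ i, Matrix (Fin (n i)) (Fin (m i)) ℝ) ×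
    (∀ i, Matrix (Fin (p i)) (Fin (n i)) ℝ)

/-- States `(x, ξ, ζ)` of the closed loop: plants, observers and integrators of all agents. -/
abbrev ClosedLoopState (N : ℕ) (n p : Fin N → ℕ) : Type :=
  (∀ i, Fin (n i) → ℝ) × (∀ i, Fin (n i) → ℝ) × (∀ i, Fin (p i) → ℝ)

section ClosedLoop

variable {N : ℕ} {n m p : Fin N → ℕ}

/-- The joint output `y`, with `y_i = (C_i + ΔC_i) x_i`. -/
def plantOutput (C : ∀ i, Matrix (Fin (p i)) (Fin (n i)) ℝ) (μ : Uncertainty N n m p)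
    (z : ClosedLoopState N n p) : ∀ i, Fin (p i) → ℝ :=
  fun i => (C i + μ.2.2 i) *ᵥ z.1 i

/-- The control inputs `u_i = K_i1 ξ_i + K_i2 ζ_i`. -/
def controlInput (K₁ : ∀ i, Matrix (Fin (m i)) (Fin (n i)) ℝ)
    (K₂ : ∀ i, Matrix (Fin (m i)) (Fin (p i)) ℝ) (z : ClosedLoopState N n p) :
    ∀ i, Fin (m i) → ℝ :=
  fun i => K₁ i *ᵥ z.2.1 i + K₂ i *ᵥ z.2.2 i

/-- The right-hand side of the closed loop of the disturbance-free uncertain agents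
`ẋ_i = (A_i + ΔA_i) x_i + (B_i + ΔB_i) u_i`, `y_i = (C_i + ΔC_i) x_i`, with the strategy
`ξ̇_i = A_i ξ_i + B_i u_i - L_i (ê_i - e_i)`, `ζ̇_i = e_i`, `u_i = K_i1 ξ_i + K_i2 ζ_i`, where
`e_i = ∇_i J_i (y_i, y_{N_i})` and
`ê_i = (R_ii + R_iiᵀ) C_i ξ_i + ∑_{j ∈ N_i} R_ij C_j ξ_j`. -/
def closedLoop (A : ∀ i, Matrix (Fin (n i)) (Fin (n i)) ℝ)
    (B : ∀ i, Matrix (Fin (n i)) (Fin (m i)) ℝ) (C : ∀ i, Matrix (Fin (p i)) (Fin (n i)) ℝ)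
    (G : NetworkGame N p) (L : ∀ i, Matrix (Fin (n i)) (Fin (p i)) ℝ)
    (K₁ : ∀ i, Matrix (Fin (m i)) (Fin (n i)) ℝ) (K₂ : ∀ i, Matrix (Fin (m i)) (Fin (p i)) ℝ)
    (μ : Uncertainty N n m p) (z : ClosedLoopState N n p) : ClosedLoopState N n p :=
  (fun i => (A i + μ.1 i) *ᵥ z.1 i + (B i + μ.2.1 i) *ᵥ controlInput K₁ K₂ z i,
   fun i => A i *ᵥ z.2.1 i + B i *ᵥ controlInput K₁ K₂ z i
      - L i *ᵥ (G.linGrad i (fun j => C j *ᵥ z.2.1 j) - G.partialGrad i (plantOutput C μ z)),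
   fun i => G.partialGrad i (plantOutput C μ z))

end ClosedLoop

/-- `z` solves the autonomous equation `ż = f(z)` on `[0, ∞)`. -/
def IsTrajectory {E : Type*} [NormedAddCommGroup E] [NormedSpace ℝ E] (f : E → E) (z : ℝ → E) :
    Prop :=
  ∀ t ∈ Ici (0 : ℝ), HasDerivWithinAt z (f (z t)) (Ici 0) t

/-- `z₀` is an equilibrium of `ż = f(z)` that is globally exponentially stable. -/
def IsGloballyExpStable {E : Type*} [NormedAddCommGroup E] [NormedSpace ℝ E] (f : E → E)
    (z₀ : E) : Prop :=
  f z₀ = 0 ∧ ∃ M > 0, ∃ ρ > 0, ∀ z : ℝ → E, IsTrajectory f z →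
    ∀ t ∈ Ici (0 : ℝ), ‖z t - z₀‖ ≤ M * Real.exp (-ρ * t) * ‖z 0 - z₀‖

/-! Stability is carried throughout by Lyapunov forms. Spectra enter only through Lyapunov's
theorem, which converts the Hurwitz matrices of the stabilizability and detectability hypotheses,
and its converse, which gives the local Hurwitz claims.

Write Γ for the linear part of the pseudo-gradient, i.e. `linGradMap`. Monotonicity says ⟨Γy, y⟩ > 0
for y ≠ 0. Hence Γ is bijective, and since the NE are the solutions of Γy + b = 0, there is exactly
one. The same inequality drives both gain designs.

Observer (`exists_observer_gain`): detectability gives forms P_i decreasing along A_i up to a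
multiple of ‖C_i v_i‖². The gains L_i = τ P_i⁻¹ C_iᵀ turn the gradient feedback into -τ⟨Γy, y⟩ with
y = Cv, which absorbs that surplus for large τ, with no condition on the graph.

Feedback (`exists_feedback_gain`): K_i1 stabilizes each plant. The rank condition gives AX + BY = 0
and CX = 1, so K_i2 can be chosen such that a frozen ζ produces the steady output -εζ. The
integrators then see the slow dynamics -εΓ, stable by monotonicity, and small ε suffices
(`HasLyapunovForm.exists_integral_action`).

At μ = 0 the observation error decouples, and a cascade argument joins the two designs. One Lyapunov
form survives small μ, so the closed loop keeps an exponentially stable equilibrium. There ζ̇ = 0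
forces the gradient at the true output to vanish, so that output is y*. -/

/-! ### Lyapunov forms and Hurwitz matrices -/

/-- `P` is a Lyapunov form for `f`: a positive definite symmetric bilinear form that decreases
strictly along the flow of `f`. -/
def IsLyapunovForm {E : Type*} [AddCommGroup E] [Module ℝ E] (P : LinearMap.BilinForm ℝ E)
    (f : E →ₗ[ℝ] E) : Prop :=
  (∀ u v, P u v = P v u) ∧ (∀ v, v ≠ 0 → 0 < P v v) ∧ ∀ v, v ≠ 0 → P (f v) v < 0

/-- The linear map `f` admits a Lyapunov form. -/
def HasLyapunovForm {E : Type*} [AddCommGroup E] [Module ℝ E] (f : E →ₗ[ℝ] E) : Prop :=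
  ∃ P : LinearMap.BilinForm ℝ E, IsLyapunovForm P f

/-- If some power of the Euler step `1 + h f` contracts a positive definite form, then `f` has a
Lyapunov form. -/
theorem hasLyapunovForm_of_eulerStep_pow_lt {E : Type*} [AddCommGroup E] [Module ℝ E]
    (f : E →ₗ[ℝ] E) (q : LinearMap.BilinForm ℝ E) (hsymm : ∀ u v, q u v = q v u)
    (hpos : ∀ v, v ≠ 0 → 0 < q v v) (h : ℝ) (hh : 0 < h) (K : ℕ)
    (hK : ∀ v, v ≠ 0 → q (((1 + h • f : Module.End ℝ E) ^ K) v)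
      (((1 + h • f : Module.End ℝ E) ^ K) v) < q v v) : HasLyapunovForm f := by
  set T : Module.End ℝ E := 1 + h • f with hT
  have hnonneg : ∀ v, 0 ≤ q v v := fun v => by
    rcases eq_or_ne v 0 with rfl | hv
    · simp
    · exact (hpos v hv).le
  -- Discrete analogue of the integral of q along the flow: P(Tv, Tv) - P(v, v) telescopes to q(T^K
  -- v, T^K v) - q(v, v).
  let P : LinearMap.BilinForm ℝ E := ∑ k ∈ Finset.range K, q.compl₁₂ (T ^ k) (T ^ k)
  have hP : ∀ u v, P u v = ∑ k ∈ Finset.range K, q ((T ^ k) u) ((T ^ k) v) := fun u v => by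
    simp [P, LinearMap.sum_apply]
  have hPs : ∀ u v, P u v = P v u := fun u v => by
    rw [hP, hP]; exact Finset.sum_congr rfl fun k _ => hsymm _ _
  refine ⟨P, hPs, fun v hv => ?_, fun v hv => ?_⟩
  · rw [hP]
    have hK0 : 0 ∈ Finset.range K := by
      rw [Finset.mem_range, Nat.pos_iff_ne_zero]
      rintro rfl
      exact absurd (hK v hv) (by simp)
    exact Finset.sum_pos' (fun k _ => hnonneg _) ⟨0, hK0, by simpa using hpos v hv⟩
  · have h1 : P (T v) (T v) - P v v < 0 := by
      have : P (T v) (T v) - P v v = q ((T ^ K) v) ((T ^ K) v) - q v v := by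
        rw [hP, hP, ← Finset.sum_sub_distrib]
        have := Finset.sum_range_sub (fun k => q ((T ^ k) v) ((T ^ k) v)) K
        simpa [pow_succ] using this
      rw [this]
      linarith [hK v hv]
    have h2 : P (T v) (T v) = P v v + 2 * h * P (f v) v + h ^ 2 * P (f v) (f v) := by
      simp only [hT, LinearMap.add_apply, Module.End.one_apply, LinearMap.smul_apply, map_add,
        map_smul, smul_eq_mul, hPs v (f v)]
      ring
    -- The second order term has the favourable sign, so the decrease over one Euler step forces
    -- P(fv, v) < 0 without any smallness of h.
    have h3 : 0 ≤ P (f v) (f v) := by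
      rw [hP]; exact Finset.sum_nonneg fun k _ => hnonneg _
    by_contra hc
    nlinarith [mul_nonneg hh.le (not_lt.1 hc), mul_nonneg (sq_nonneg h) h3]

/-- A complex matrix whose spectrum lies in the open unit disc has powers tending to zero. -/
theorem tendsto_pow_apply_of_spectrum_lt_one {k : ℕ} (T : Matrix (Fin k) (Fin k) ℂ)
    (hT : ∀ z ∈ spectrum ℂ T, ‖z‖ < 1) (i j : Fin k) :
    Tendsto (fun r : ℕ => (T ^ r) i j) atTop (𝓝 0) := by
  let _ : NormedRing (Matrix (Fin k) (Fin k) ℂ) := Matrix.linftyOpNormedRing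
  let _ : NormedAlgebra ℂ (Matrix (Fin k) (Fin k) ℂ) := Matrix.linftyOpNormedAlgebra
  have : Nonempty (Fin k) := ⟨i⟩
  have : CompleteSpace (Matrix (Fin k) (Fin k) ℂ) := FiniteDimensional.complete ℂ _
  have h1 : spectralRadius ℂ T < ((1 : NNReal) : ENNReal) :=
    spectrum.spectralRadius_lt_of_forall_lt T fun z hz => by exact_mod_cast hT z hz
  -- With s between the spectral radius and 1, Gelfand's formula gives ‖T^r‖ ≤ s^r for large r.
  obtain ⟨s, hs1, hs2⟩ := ENNReal.lt_iff_exists_nnreal_btwn.1 h1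
  have h2 := (spectrum.pow_nnnorm_pow_one_div_tendsto_nhds_spectralRadius T).eventually_lt_const hs1
  have hs3 : s < 1 := by exact_mod_cast hs2
  have h3 : ∀ᶠ r : ℕ in atTop, ‖(T ^ r) i j‖ ≤ (s : ℝ) ^ r := by
    filter_upwards [h2, eventually_gt_atTop 0] with r hr hr0
    have h4 : (‖T ^ r‖₊ : ENNReal) ≤ (s : ENNReal) ^ (r : ℝ) := by
      have := ENNReal.rpow_le_rpow hr.le (Nat.cast_nonneg r : (0 : ℝ) ≤ r)
      rwa [← ENNReal.rpow_mul, one_div_mul_cancel (by positivity), ENNReal.rpow_one] at this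
    rw [ENNReal.rpow_natCast] at h4
    have h5 : ‖T ^ r‖₊ ≤ s ^ r := by exact_mod_cast h4
    have h6 : ‖(T ^ r) i j‖₊ ≤ ‖T ^ r‖₊ := by
      rw [Matrix.linfty_opNNNorm_def]
      exact (Finset.single_le_sum (f := fun j => ‖(T ^ r) i j‖₊) (fun _ _ => zero_le)
        (Finset.mem_univ j)).trans
        (Finset.le_sup (f := fun i => ∑ j, ‖(T ^ r) i j‖₊) (Finset.mem_univ i))
    exact_mod_cast h6.trans h5
  exact squeeze_zero_norm' h3 (tendsto_pow_atTop_nhds_zero_of_lt_one s.2 (by exact_mod_cast hs3))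

/-- The standard dot product as a bilinear form. -/
noncomputable def dotForm (ι : Type*) [Fintype ι] : LinearMap.BilinForm ℝ (ι → ℝ) :=
  dotProductBilin ℝ ℝ

theorem dotProduct_self_pos_of_ne_zero {ι : Type*} [Fintype ι] {v : ι → ℝ} (hv : v ≠ 0) :
    0 < v ⬝ᵥ v := by
  have h0 : 0 ≤ v ⬝ᵥ v := Finset.sum_nonneg fun i _ => mul_self_nonneg _
  exact lt_of_le_of_ne h0 fun h => hv (dotProduct_self_eq_zero.1 h.symm)

/-- A matrix whose powers tend to zero eventually contracts the dot product. -/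
theorem exists_pow_mulVec_dotProduct_lt {k : ℕ} (T : Matrix (Fin k) (Fin k) ℝ)
    (hT : ∀ i j, Tendsto (fun r : ℕ => (T ^ r) i j) atTop (𝓝 0)) :
    ∃ K : ℕ, ∀ v : Fin k → ℝ, v ≠ 0 → (T ^ K *ᵥ v) ⬝ᵥ (T ^ K *ᵥ v) < v ⬝ᵥ v := by
  have h1 : Tendsto (fun r : ℕ => ∑ i, ∑ j, (T ^ r) i j ^ 2) atTop (𝓝 0) := by
    have : Tendsto (fun r : ℕ => ∑ i, ∑ j, (T ^ r) i j ^ 2) atTop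
        (𝓝 (∑ _i : Fin k, ∑ _j : Fin k, (0 : ℝ) ^ 2)) :=
      tendsto_finsetSum _ fun i _ => tendsto_finsetSum _ fun j _ => (hT i j).pow 2
    simpa using this
  -- A power with Frobenius norm below 1 contracts, by Cauchy–Schwarz on each row.
  obtain ⟨K, hK⟩ := (h1.eventually_lt_const one_pos).exists
  refine ⟨K, fun v hv => ?_⟩
  have hv' := dotProduct_self_pos_of_ne_zero hv
  calc (T ^ K *ᵥ v) ⬝ᵥ (T ^ K *ᵥ v) = ∑ i, (∑ j, (T ^ K) i j * v j) ^ 2 := by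
        simp [dotProduct, mulVec, sq]
    _ ≤ ∑ i, (∑ j, (T ^ K) i j ^ 2) * (∑ j, v j ^ 2) :=
        Finset.sum_le_sum fun i _ => Finset.sum_mul_sq_le_sq_mul_sq _ _ _
    _ = (∑ i, ∑ j, (T ^ K) i j ^ 2) * (v ⬝ᵥ v) := by
        rw [← Finset.sum_mul]; simp [dotProduct, sq]
    _ < v ⬝ᵥ v := by nlinarith

/-- A finite set in the open left half plane is mapped into the unit disc by a short Euler step. -/
theorem exists_pos_forall_norm_one_add_mul_lt_one {S : Set ℂ} (hS : S.Finite)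
    (h : ∀ z ∈ S, z.re < 0) : ∃ r : ℝ, 0 < r ∧ ∀ z ∈ S, ‖1 + (r : ℂ) * z‖ < 1 := by
  have h1 : ∀ z ∈ S, ∀ᶠ r : ℝ in 𝓝[>] 0, ‖1 + (r : ℂ) * z‖ < 1 := by
    intro z hz
    -- |1 + rz|² = 1 + r(2 Re z + r|z|²), and the bracket is negative for small r.
    have hc : Tendsto (fun r : ℝ => 2 * z.re + r * Complex.normSq z) (𝓝[>] 0)
        (𝓝 (2 * z.re + 0 * Complex.normSq z)) :=
      (Continuous.tendsto (by fun_prop) 0).mono_left nhdsWithin_le_nhds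
    filter_upwards [hc.eventually_lt_const (u := 0) (by linarith [h z hz]),
      self_mem_nhdsWithin] with r hr hr0
    have hr0 : 0 < r := hr0
    rw [← abs_of_nonneg (norm_nonneg _), ← sq_lt_one_iff_abs_lt_one, ← Complex.normSq_eq_norm_sq,
      Complex.normSq_apply]
    simp only [Complex.add_re, Complex.one_re, Complex.mul_re, Complex.ofReal_re, Complex.add_im,
      Complex.ofReal_im, Complex.one_im, Complex.mul_im, zero_mul, sub_zero, zero_add, add_zero]
    rw [Complex.normSq_apply] at hr
    nlinarith [mul_neg_of_pos_of_neg hr0 hr]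
  obtain ⟨r, hr, hr0⟩ :=
    (((eventually_all_finite hS).2 h1).and self_mem_nhdsWithin).exists
  exact ⟨r, hr0, hr⟩

/-- Lyapunov's theorem: a Hurwitz matrix has a Lyapunov form. -/
theorem IsHurwitz.hasLyapunovForm {k : ℕ} {M : Matrix (Fin k) (Fin k) ℝ} (hM : IsHurwitz M) :
    HasLyapunovForm M.mulVecLin := by
  obtain ⟨h, hh, hz⟩ := exists_pos_forall_norm_one_add_mul_lt_one (Matrix.finite_spectrum _) hM
  set Mc : Matrix (Fin k) (Fin k) ℂ := M.map (fun r : ℝ => (r : ℂ)) with hMc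
  have hmap : ((1 + h • M).map (fun r : ℝ => (r : ℂ))) = 1 + (h : ℂ) • Mc := by
    ext i j
    simp [hMc, Matrix.one_apply, apply_ite]
  have hspec : ∀ z ∈ spectrum ℂ (1 + (h : ℂ) • Mc), ‖z‖ < 1 := by
    intro z hz'
    have h0 : (h : ℂ) ≠ 0 := by exact_mod_cast hh.ne'
    have h1 : (1 : Matrix (Fin k) (Fin k) ℂ) + (h : ℂ) • Mc = algebraMap ℂ _ 1 +
        (Units.mk0 (h : ℂ) h0) • Mc := by simp [Units.smul_def]
    rw [h1, ← spectrum.singleton_add_eq, spectrum.unit_smul_eq_smul] at hz'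
    obtain ⟨a, rfl, b, ⟨c, hc, rfl⟩, rfl⟩ := hz'
    exact hz c hc
  obtain ⟨K, hK⟩ := exists_pow_mulVec_dotProduct_lt (1 + h • M) fun i j => by
    have h1 := tendsto_pow_apply_of_spectrum_lt_one _ hspec i j
    have h2 : ∀ r : ℕ, ((1 + (h : ℂ) • Mc) ^ r) i j = (((1 + h • M) ^ r) i j : ℝ) := by
      intro r
      rw [← hmap]
      have := map_pow (Complex.ofRealHom.mapMatrix (m := Fin k)) (1 + h • M) r
      exact (congrFun (congrFun this i) j).symm
    simp only [h2] at h1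
    exact Complex.continuous_re.continuousAt.tendsto.comp h1
  refine hasLyapunovForm_of_eulerStep_pow_lt _ (dotForm (Fin k)) (fun u v => dotProduct_comm u v)
    (fun v hv => dotProduct_self_pos_of_ne_zero hv) h hh K fun v hv => ?_
  have h3 : (1 + h • M.mulVecLin : Module.End ℝ (Fin k → ℝ)) = Matrix.toLinAlgEquiv' (1 + h • M) := by
    ext v; simp [Matrix.toLinAlgEquiv'_apply]
  rw [h3, ← map_pow]
  exact hK v hv

/-- A matrix with a Lyapunov form is Hurwitz. -/
theorem HasLyapunovForm.isHurwitz {k : ℕ} {M : Matrix (Fin k) (Fin k) ℝ}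
    (hM : HasLyapunovForm M.mulVecLin) : IsHurwitz M := by
  obtain ⟨P, hs, hp, hn⟩ := hM
  intro z hz
  rw [← Matrix.spectrum_toLin', ← Module.End.hasEigenvalue_iff_mem_spectrum] at hz
  obtain ⟨w, hw⟩ := hz.exists_hasEigenvector
  have hw1 : (M.map (fun r : ℝ => (r : ℂ))) *ᵥ w = z • w := by
    simpa using hw.apply_eq_smul
  have hre : M *ᵥ (fun i => (w i).re) = z.re • (fun i => (w i).re) - z.im • (fun i => (w i).im) := by
    ext i
    have := congrArg Complex.re (congrFun hw1 i)
    simpa [mulVec, dotProduct, Complex.re_sum] using this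
  have him : M *ᵥ (fun i => (w i).im) = z.re • (fun i => (w i).im) + z.im • (fun i => (w i).re) := by
    ext i
    have := congrArg Complex.im (congrFun hw1 i)
    simpa [mulVec, dotProduct, Complex.im_sum] using this
  set a : Fin k → ℝ := fun i => (w i).re
  set b : Fin k → ℝ := fun i => (w i).im
  have hne : a ≠ 0 ∨ b ≠ 0 := by
    by_contra! h
    refine hw.2 (funext fun i => Complex.ext ?_ ?_)
    · simpa using congrFun h.1 i
    · simpa using congrFun h.2 i
  have hp' : ∀ v, 0 ≤ P v v := fun v => by
    rcases eq_or_ne v 0 with rfl | hv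
    · simp
    · exact (hp v hv).le
  have hn' : ∀ v, P (M *ᵥ v) v ≤ 0 := fun v => by
    rcases eq_or_ne v 0 with rfl | hv
    · simp
    · exact (hn v hv).le
  -- For the eigenvector a + ib the cross terms in Im z cancel by symmetry of P, so the sign of Re z
  -- can be read off.
  have hsum : P (M *ᵥ a) a + P (M *ᵥ b) b = z.re * (P a a + P b b) := by
    rw [hre, him]
    simp only [map_sub, map_add, map_smul, LinearMap.sub_apply, LinearMap.add_apply,
      LinearMap.smul_apply, smul_eq_mul, hs b a]
    ring
  have hlt : P (M *ᵥ a) a + P (M *ᵥ b) b < 0 := by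
    rcases hne with h | h
    · have := hn a h; simp only [mulVecLin_apply] at this; linarith [hn' b]
    · have := hn b h; simp only [mulVecLin_apply] at this; linarith [hn' a]
  have hpos : 0 ≤ P a a + P b b := add_nonneg (hp' a) (hp' b)
  by_contra hc
  nlinarith [mul_nonneg (not_lt.1 hc) hpos]

/-! ### Norm estimates for bilinear forms -/

/-- A positive definite bilinear form on a finite-dimensional space is coercive. -/
theorem exists_mul_norm_sq_le_of_pos {E : Type*} [NormedAddCommGroup E] [NormedSpace ℝ E]
    [FiniteDimensional ℝ E] (q : LinearMap.BilinForm ℝ E) (hq : ∀ v, v ≠ 0 → 0 < q v v) :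
    ∃ a : ℝ, 0 < a ∧ ∀ v, a * ‖v‖ ^ 2 ≤ q v v := by
  have := FiniteDimensional.proper ℝ E
  rcases subsingleton_or_nontrivial E with hE | hE
  · exact ⟨1, one_pos, fun v => by simp [Subsingleton.elim v 0]⟩
  have hcont : Continuous fun v => q v v := by
    have h1 : Continuous fun v => q.toContinuousBilinearMap v v := by fun_prop
    exact h1
  obtain ⟨w, hw, hmin⟩ := (isCompact_sphere (0 : E) 1).exists_isMinOn
    (NormedSpace.sphere_nonempty.2 zero_le_one) hcont.continuousOn
  have hw0 : w ≠ 0 := by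
    rintro rfl
    simp at hw
  refine ⟨q w w, hq w hw0, fun v => ?_⟩
  rcases eq_or_ne v 0 with rfl | hv
  · simp
  have hv' : 0 < ‖v‖ := norm_pos_iff.2 hv
  have h1 : q w w ≤ q (‖v‖⁻¹ • v) (‖v‖⁻¹ • v) :=
    hmin (by simp [norm_smul, hv'.ne'])
  simp only [map_smul, LinearMap.smul_apply, smul_eq_mul] at h1
  have h2 := mul_le_mul_of_nonneg_right h1 (sq_nonneg ‖v‖)
  have h3 : ‖v‖⁻¹ * (‖v‖⁻¹ * q v v) * ‖v‖ ^ 2 = q v v := by field_simp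
  linarith

/-- A bilinear map on finite-dimensional spaces is bounded. -/
theorem exists_abs_le_mul_norm {E F : Type*} [NormedAddCommGroup E] [NormedSpace ℝ E]
    [FiniteDimensional ℝ E] [NormedAddCommGroup F] [NormedSpace ℝ F] [FiniteDimensional ℝ F]
    (q : E →ₗ[ℝ] F →ₗ[ℝ] ℝ) : ∃ b : ℝ, 0 < b ∧ ∀ u v, |q u v| ≤ b * ‖u‖ * ‖v‖ := by
  refine ⟨‖q.toContinuousBilinearMap‖ + 1, by positivity, fun u v => ?_⟩
  have h1 := q.toContinuousBilinearMap.le_opNorm₂ u v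
  rw [LinearMap.toContinuousBilinearMap_apply, Real.norm_eq_abs] at h1
  have h2 : 0 ≤ ‖u‖ * ‖v‖ := by positivity
  nlinarith

/-- Coercivity needs no symmetry, so it applies to the form -P(f·, ·). -/
theorem IsLyapunovForm.exists_apply_le {E : Type*} [NormedAddCommGroup E] [NormedSpace ℝ E]
    [FiniteDimensional ℝ E] {P : LinearMap.BilinForm ℝ E} {f : E →ₗ[ℝ] E}
    (h : IsLyapunovForm P f) : ∃ a : ℝ, 0 < a ∧ ∀ v, P (f v) v ≤ -(a * ‖v‖ ^ 2) := by
  obtain ⟨a, ha, h1⟩ := exists_mul_norm_sq_le_of_pos (-(P ∘ₗ f)) fun v hv => by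
    simpa using h.2.2 v hv
  refine ⟨a, ha, fun v => ?_⟩
  have := h1 v
  simp only [LinearMap.neg_apply, LinearMap.comp_apply] at this
  linarith

theorem HasLyapunovForm.injective {E : Type*} [AddCommGroup E] [Module ℝ E] {f : E →ₗ[ℝ] E}
    (h : HasLyapunovForm f) : Function.Injective f := by
  obtain ⟨P, -, -, hn⟩ := h
  rw [← LinearMap.ker_eq_bot, LinearMap.ker_eq_bot']
  intro v hv
  by_contra hv0
  simpa [hv] using hn v hv0

/-! ### Conjugation, products, cascades and slow-fast couplings -/

/-- Lyapunov forms are transported along linear equivalences. -/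
theorem HasLyapunovForm.of_conj {E E' : Type*} [AddCommGroup E] [Module ℝ E] [AddCommGroup E']
    [Module ℝ E'] {f : E →ₗ[ℝ] E} (h : HasLyapunovForm f) (e : E' ≃ₗ[ℝ] E) (g : E' →ₗ[ℝ] E')
    (hg : ∀ v, e (g v) = f (e v)) : HasLyapunovForm g := by
  obtain ⟨P, hs, hp, hn⟩ := h
  refine ⟨P.compl₁₂ e.toLinearMap e.toLinearMap, fun u v => hs _ _,
    fun v hv => hp _ (by simpa using hv), fun v hv => ?_⟩
  have := hn (e v) (by simpa using hv)
  rw [← hg] at this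
  exact this

/-- The sum of the forms `P i` on the coordinates of a product. -/
noncomputable def piForm {ι : Type*} [Fintype ι] {E : ι → Type*} [∀ i, AddCommGroup (E i)]
    [∀ i, Module ℝ (E i)] (P : ∀ i, LinearMap.BilinForm ℝ (E i)) :
    LinearMap.BilinForm ℝ (∀ i, E i) :=
  ∑ i, (P i).compl₁₂ (LinearMap.proj i) (LinearMap.proj i)

theorem piForm_apply {ι : Type*} [Fintype ι] {E : ι → Type*} [∀ i, AddCommGroup (E i)]
    [∀ i, Module ℝ (E i)] (P : ∀ i, LinearMap.BilinForm ℝ (E i)) (u v : ∀ i, E i) :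
    piForm P u v = ∑ i, P i (u i) (v i) := by
  simp [piForm, LinearMap.sum_apply]

theorem piForm_pos {ι : Type*} [Fintype ι] {E : ι → Type*} [∀ i, AddCommGroup (E i)]
    [∀ i, Module ℝ (E i)] (P : ∀ i, LinearMap.BilinForm ℝ (E i))
    (hP : ∀ i, ∀ v, v ≠ 0 → 0 < P i v v) (v : ∀ i, E i) (hv : v ≠ 0) : 0 < piForm P v v := by
  rw [piForm_apply]
  obtain ⟨i, hi⟩ := Function.ne_iff.1 hv
  refine Finset.sum_pos' (fun j _ => ?_) ⟨i, Finset.mem_univ i, hP i _ hi⟩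
  rcases eq_or_ne (v j) 0 with h | h
  · simp [h]
  · exact (hP j _ h).le

/-- A block diagonal map has a Lyapunov form if all its blocks do. -/
theorem HasLyapunovForm.pi {ι : Type*} [Fintype ι] {E : ι → Type*} [∀ i, AddCommGroup (E i)]
    [∀ i, Module ℝ (E i)] {f : ∀ i, E i →ₗ[ℝ] E i} (h : ∀ i, HasLyapunovForm (f i)) :
    HasLyapunovForm (LinearMap.pi fun i => f i ∘ₗ LinearMap.proj i) := by
  choose P hs hp hn using h
  refine ⟨piForm P, fun u v => ?_, piForm_pos P hp, fun v hv => ?_⟩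
  · rw [piForm_apply, piForm_apply]
    exact Finset.sum_congr rfl fun i _ => hs i _ _
  · have := piForm_pos (fun i => -(P i ∘ₗ f i)) (fun i w hw => by simpa using hn i w hw) v hv
    rw [piForm_apply] at this ⊢
    simpa using this

/-- The sum of two forms on the coordinates of a product. -/
noncomputable def prodForm {E F : Type*} [AddCommGroup E] [Module ℝ E] [AddCommGroup F]
    [Module ℝ F] (P : LinearMap.BilinForm ℝ E) (Q : LinearMap.BilinForm ℝ F) :
    LinearMap.BilinForm ℝ (E × F) :=
  P.compl₁₂ (LinearMap.fst ℝ E F) (LinearMap.fst ℝ E F) +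
    Q.compl₁₂ (LinearMap.snd ℝ E F) (LinearMap.snd ℝ E F)

theorem prodForm_apply {E F : Type*} [AddCommGroup E] [Module ℝ E] [AddCommGroup F]
    [Module ℝ F] (P : LinearMap.BilinForm ℝ E) (Q : LinearMap.BilinForm ℝ F) (u v : E × F) :
    prodForm P Q u v = P u.1 v.1 + Q u.2 v.2 := by
  simp [prodForm]

theorem prodForm_pos {E F : Type*} [AddCommGroup E] [Module ℝ E] [AddCommGroup F]
    [Module ℝ F] {P : LinearMap.BilinForm ℝ E} {Q : LinearMap.BilinForm ℝ F}
    (hP : ∀ v, v ≠ 0 → 0 < P v v) (hQ : ∀ v, v ≠ 0 → 0 < Q v v) (v : E × F) (hv : v ≠ 0) :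
    0 < prodForm P Q v v := by
  rw [prodForm_apply]
  have hP' : 0 ≤ P v.1 v.1 := by
    rcases eq_or_ne v.1 0 with h | h
    · simp [h]
    · exact (hP _ h).le
  have hQ' : 0 ≤ Q v.2 v.2 := by
    rcases eq_or_ne v.2 0 with h | h
    · simp [h]
    · exact (hQ _ h).le
  by_cases h1 : v.1 = 0
  · have h2 : v.2 ≠ 0 := fun h2 => hv (Prod.ext h1 h2)
    linarith [hQ _ h2]
  · linarith [hP _ h1]

/-- A cascade of two maps with Lyapunov forms has a Lyapunov form. -/
theorem HasLyapunovForm.cascade {E F : Type*} [NormedAddCommGroup E] [NormedSpace ℝ E]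
    [FiniteDimensional ℝ E] [NormedAddCommGroup F] [NormedSpace ℝ F] [FiniteDimensional ℝ F]
    {f : E →ₗ[ℝ] E} {g : F →ₗ[ℝ] F} (hf : HasLyapunovForm f) (hg : HasLyapunovForm g)
    (h : F →ₗ[ℝ] E) :
    HasLyapunovForm ((f.coprod h).prod (g ∘ₗ LinearMap.snd ℝ E F)) := by
  obtain ⟨P, hP⟩ := hf
  obtain ⟨Q, hQ⟩ := hg
  obtain ⟨a, ha, hPa⟩ := hP.exists_apply_le
  obtain ⟨c, hc, hQc⟩ := hQ.exists_apply_le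
  obtain ⟨b, hb, hPb⟩ := exists_abs_le_mul_norm (P ∘ₗ h)
  -- By Young's inequality the coupling costs (a/2)‖v.1‖² + (b²/2a)‖v.2‖². This weight makes the
  -- decrease in the second component kc = b²/a, twice what is needed.
  set k : ℝ := b ^ 2 / (a * c) with hk
  have hk0 : 0 < k := by positivity
  refine ⟨prodForm P (k • Q), fun u v => ?_, prodForm_pos hP.2.1 fun v hv => ?_, fun v hv => ?_⟩
  · simp [prodForm_apply, hP.1 u.1, hQ.1 u.2]
  · simpa using mul_pos hk0 (hQ.2.1 v hv)
  · have h1 := hPa v.1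
    have h2 := mul_le_mul_of_nonneg_left (hQc v.2) hk0.le
    have h3 := (abs_le.1 (hPb v.2 v.1)).2
    simp only [LinearMap.comp_apply] at h3
    simp only [prodForm_apply, LinearMap.prod_apply, Function.prod, LinearMap.coprod_apply,
      LinearMap.comp_apply, LinearMap.snd_apply, map_add, LinearMap.add_apply,
      LinearMap.smul_apply, smul_eq_mul]
    have h4 : k * (c * ‖v.2‖ ^ 2) = b ^ 2 / a * ‖v.2‖ ^ 2 := by
      rw [hk]; field_simp
    have h5 : b * ‖v.2‖ * ‖v.1‖ = a / 2 * ‖v.1‖ ^ 2 + b ^ 2 / (2 * a) * ‖v.2‖ ^ 2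
        - (a * ‖v.1‖ - b * ‖v.2‖) ^ 2 / (2 * a) := by
      field_simp; ring
    have h6 : 0 ≤ (a * ‖v.1‖ - b * ‖v.2‖) ^ 2 / (2 * a) := by positivity
    have h7 : b ^ 2 / a * ‖v.2‖ ^ 2 = 2 * (b ^ 2 / (2 * a) * ‖v.2‖ ^ 2) := by
      field_simp
    have h8 : 0 < a / 2 * ‖v.1‖ ^ 2 + b ^ 2 / (2 * a) * ‖v.2‖ ^ 2 := by
      by_cases hv1 : v.1 = 0
      · have hv2 : v.2 ≠ 0 := fun h2 => hv (Prod.ext hv1 h2)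
        have := norm_pos_iff.2 hv2
        positivity
      · have := norm_pos_iff.2 hv1
        positivity
    linarith

/-- A fast map `f` coupled to a slow map `-r`, with couplings of the order of the slow time
scale, has a Lyapunov form. -/
theorem HasLyapunovForm.exists_slow_fast {E F : Type*} [NormedAddCommGroup E] [NormedSpace ℝ E]
    [FiniteDimensional ℝ E] [NormedAddCommGroup F] [NormedSpace ℝ F] [FiniteDimensional ℝ F]
    {f : E →ₗ[ℝ] E} {r : F →ₗ[ℝ] F} (hf : HasLyapunovForm f) (hr : HasLyapunovForm (-r))
    (g : F →ₗ[ℝ] E) (d : E →ₗ[ℝ] E) (j : E →ₗ[ℝ] F) :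
    ∃ ε : ℝ, 0 < ε ∧ HasLyapunovForm
      (((f + ε • d).coprod (ε • g)).prod ((-(ε • j)).coprod (-(ε • r)))) := by
  obtain ⟨P, hP⟩ := hf
  obtain ⟨Q, hQ⟩ := hr
  obtain ⟨a, ha, hPa⟩ := hP.exists_apply_le
  obtain ⟨c, hc, hQc⟩ := hQ.exists_apply_le
  obtain ⟨b₁, hb₁, h₁⟩ := exists_abs_le_mul_norm (P ∘ₗ g)
  obtain ⟨b₂, hb₂, h₂⟩ := exists_abs_le_mul_norm (P ∘ₗ d)
  obtain ⟨b₃, hb₃, h₃⟩ := exists_abs_le_mul_norm (Q ∘ₗ j)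
  set b : ℝ := b₁ + b₃ with hb
  have hb0 : 0 < b := by positivity
  -- All couplings and the slow decrease scale with ε. Young's inequality charges half of the slow
  -- decrease for the mixed terms, and the remaining cost ε(b₂ + b²/2c)‖v.1‖² is set to half of the
  -- fast decrease.
  set ε : ℝ := a / (2 * (b₂ + b ^ 2 / (2 * c))) with hε
  have hε0 : 0 < ε := by positivity
  have hεa : ε * (b₂ + b ^ 2 / (2 * c)) = a / 2 := by
    rw [hε]; field_simp
  refine ⟨ε, hε0, prodForm P Q, fun u v => ?_, prodForm_pos hP.2.1 hQ.2.1, fun v hv => ?_⟩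
  · simp [prodForm_apply, hP.1 u.1, hQ.1 u.2]
  · have e₁ := (abs_le.1 (h₁ v.2 v.1)).2
    have e₂ := (abs_le.1 (h₂ v.1 v.1)).2
    have e₃ := (abs_le.1 (h₃ v.1 v.2)).1
    have e₄ := hPa v.1
    have e₅ := hQc v.2
    simp only [LinearMap.comp_apply, LinearMap.neg_apply, map_neg] at e₁ e₂ e₃ e₅
    simp only [prodForm_apply, LinearMap.prod_apply, Function.prod, LinearMap.coprod_apply,
      map_add, LinearMap.add_apply, LinearMap.neg_apply, map_neg,
      LinearMap.smul_apply, map_smul, smul_eq_mul]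
    have h5 : b * ‖v.1‖ * ‖v.2‖ = c / 2 * ‖v.2‖ ^ 2 + b ^ 2 / (2 * c) * ‖v.1‖ ^ 2
        - (c * ‖v.2‖ - b * ‖v.1‖) ^ 2 / (2 * c) := by
      field_simp; ring
    have h6 : 0 ≤ (c * ‖v.2‖ - b * ‖v.1‖) ^ 2 / (2 * c) := by positivity
    have h7 : P (g v.2) v.1 + P (d v.1) v.1 - Q (j v.1) v.2 - Q (r v.2) v.2 ≤
        (b₂ + b ^ 2 / (2 * c)) * ‖v.1‖ ^ 2 - c / 2 * ‖v.2‖ ^ 2 := by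
      rw [hb] at h5 h6 ⊢
      linarith
    have h8 := mul_le_mul_of_nonneg_left h7 hε0.le
    have h10 : ε * ((b₂ + b ^ 2 / (2 * c)) * ‖v.1‖ ^ 2 - c / 2 * ‖v.2‖ ^ 2) =
        a / 2 * ‖v.1‖ ^ 2 - ε * (c / 2 * ‖v.2‖ ^ 2) := by
      rw [mul_sub, ← mul_assoc, hεa]
    rw [h10] at h8
    have h9 : 0 < a / 2 * ‖v.1‖ ^ 2 + ε * (c / 2 * ‖v.2‖ ^ 2) := by
      by_cases hv1 : v.1 = 0
      · have hv2 : v.2 ≠ 0 := fun h2 => hv (Prod.ext hv1 h2)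
        have := norm_pos_iff.2 hv2
        positivity
      · have := norm_pos_iff.2 hv1
        positivity
    linarith

/-! ### Robustness and exponential decay -/

/-- Having a Lyapunov form is stable under small perturbations of the map. -/
theorem HasLyapunovForm.eventually {X E : Type*} [TopologicalSpace X] [NormedAddCommGroup E]
    [NormedSpace ℝ E] [FiniteDimensional ℝ E] (T : X → E →ₗ[ℝ] E)
    (hT : Continuous fun z : X × E => T z.1 z.2) {x₀ : X} (h : HasLyapunovForm (T x₀)) :
    ∀ᶠ x in 𝓝 x₀, HasLyapunovForm (T x) := by
  have := FiniteDimensional.proper ℝ E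
  obtain ⟨P, hs, hp, hn⟩ := h
  have hcont : Continuous fun z : X × E => P (T z.1 z.2) z.2 := by
    have h1 : Continuous fun z : X × E => P.toContinuousBilinearMap (T z.1 z.2) z.2 := by fun_prop
    exact h1
  have h1 : ∀ᶠ x in 𝓝 x₀, ∀ v ∈ Metric.sphere (0 : E) 1, P (T x v) v < 0 := by
    -- The form P is kept fixed: strict negativity is an open condition, and compactness makes it
    -- uniform over the unit sphere.
    refine (isCompact_sphere (0 : E) 1).eventually_forall_of_forall_eventually fun v hv => ?_
    refine hcont.continuousAt.eventually_lt_const (hn v ?_)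
    rintro rfl
    simp at hv
  filter_upwards [h1] with x hx
  refine ⟨P, hs, hp, fun v hv => ?_⟩
  have hv' : 0 < ‖v‖ := norm_pos_iff.2 hv
  have h2 := hx (‖v‖⁻¹ • v) (by simp [norm_smul, hv'.ne'])
  simp only [map_smul, LinearMap.smul_apply, smul_eq_mul, ← mul_assoc] at h2
  exact (pos_iff_neg_of_mul_neg h2).1 (by positivity)

/-- An affine vector field whose linear part has a Lyapunov form is globally exponentially stable
at its zero. -/
theorem HasLyapunovForm.isGloballyExpStable {E : Type*} [NormedAddCommGroup E] [NormedSpace ℝ E]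
    [FiniteDimensional ℝ E] {f : E →ₗ[ℝ] E} (h : HasLyapunovForm f) (F : E → E) (z₀ : E)
    (hF : ∀ z, F z = f (z - z₀)) : IsGloballyExpStable F z₀ := by
  obtain ⟨P, hP⟩ := h
  obtain ⟨a, ha, hPa⟩ := hP.exists_apply_le
  obtain ⟨c, hc, hPc⟩ := exists_mul_norm_sq_le_of_pos P hP.2.1
  obtain ⟨b, hb, hPb⟩ := exists_abs_le_mul_norm P
  -- From P(v, v) ≤ b‖v‖², the derivative 2P(fv, v) ≤ -2a‖v‖² is at most -2ρP(v, v). Comparing P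
  -- with ‖·‖² at both times then gives the factor √(b/c).
  set ρ : ℝ := a / b with hρ
  have hρ0 : 0 < ρ := by positivity
  refine ⟨by simp [hF], Real.sqrt (b / c), by positivity, ρ, hρ0, fun z hz t ht => ?_⟩
  have hder : ∀ s ∈ Ici (0 : ℝ), HasDerivWithinAt
      (fun s => P (z s - z₀) (z s - z₀) * Real.exp (2 * ρ * s))
      (2 * P (f (z s - z₀)) (z s - z₀) * Real.exp (2 * ρ * s) +
        P (z s - z₀) (z s - z₀) * (Real.exp (2 * ρ * s) * (2 * ρ))) (Ici 0) s := by
    intro s hs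
    have h1 : HasDerivWithinAt (fun s => z s - z₀) (f (z s - z₀)) (Ici 0) s := by
      rw [← hF]; exact (hz s hs).sub_const z₀
    have h2 := (P.toContinuousBilinearMap).hasFDerivWithinAt_of_bilinear
      h1.hasFDerivWithinAt h1.hasFDerivWithinAt
    have h3 : HasDerivWithinAt (fun s => P (z s - z₀) (z s - z₀))
        (2 * P (f (z s - z₀)) (z s - z₀)) (Ici 0) s := by
      refine h2.hasDerivWithinAt.congr_deriv ?_
      have h4 := hP.1 (z s - z₀) (f (z s - z₀))
      simp only [map_sub, LinearMap.sub_apply] at h4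
      simp
      linarith
    have h5 : HasDerivWithinAt (fun s : ℝ => Real.exp (2 * ρ * s))
        (Real.exp (2 * ρ * s) * (2 * ρ)) (Ici 0) s := by
      have := ((hasDerivAt_id s).const_mul (2 * ρ)).exp
      simpa using this.hasDerivWithinAt
    exact h3.mul h5
  have hanti : AntitoneOn (fun s => P (z s - z₀) (z s - z₀) * Real.exp (2 * ρ * s)) (Ici 0) := by
    refine antitoneOn_of_hasDerivWithinAt_nonpos (convex_Ici 0)
      (fun s hs => (hder s hs).continuousWithinAt)
      (fun s hs => (hder s (interior_subset hs)).mono interior_subset) fun s _ => ?_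
    have h1 := hPa (z s - z₀)
    have h2 := (abs_le.1 (hPb (z s - z₀) (z s - z₀))).2
    have h3 : ρ * P (z s - z₀) (z s - z₀) ≤ a * ‖z s - z₀‖ ^ 2 := by
      calc ρ * P (z s - z₀) (z s - z₀) ≤ ρ * (b * ‖z s - z₀‖ * ‖z s - z₀‖) :=
            mul_le_mul_of_nonneg_left h2 hρ0.le
        _ = a * ‖z s - z₀‖ ^ 2 := by rw [hρ]; field_simp
    have h4 : 2 * P (f (z s - z₀)) (z s - z₀) + 2 * (ρ * P (z s - z₀) (z s - z₀)) ≤ 0 := by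
      linarith
    nlinarith [mul_nonpos_of_nonpos_of_nonneg h4 (Real.exp_pos (2 * ρ * s)).le]
  have h1 := hanti (mem_Ici.2 le_rfl) ht ht
  simp only [mul_zero, Real.exp_zero, mul_one] at h1
  have h2 := (abs_le.1 (hPb (z 0 - z₀) (z 0 - z₀))).2
  have h3 := mul_le_mul_of_nonneg_right (hPc (z t - z₀)) (Real.exp_pos (2 * ρ * t)).le
  have h4 : (‖z t - z₀‖) ^ 2 ≤ (Real.sqrt (b / c) * Real.exp (-ρ * t) * ‖z 0 - z₀‖) ^ 2 := by
    rw [mul_pow, mul_pow, Real.sq_sqrt (by positivity)]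
    have h5 : Real.exp (-ρ * t) ^ 2 * Real.exp (2 * ρ * t) = 1 := by
      rw [sq, ← Real.exp_add, ← Real.exp_add, ← Real.exp_zero]
      congr 1
      ring
    have h6 : c * ‖z t - z₀‖ ^ 2 * Real.exp (2 * ρ * t) ≤ b * ‖z 0 - z₀‖ ^ 2 := by linarith
    have h7 := mul_le_mul_of_nonneg_left h6 (sq_nonneg (Real.exp (-ρ * t)))
    have h8 : Real.exp (-ρ * t) ^ 2 * (c * ‖z t - z₀‖ ^ 2 * Real.exp (2 * ρ * t)) =
        c * ‖z t - z₀‖ ^ 2 := by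
      linear_combination (c * ‖z t - z₀‖ ^ 2) * h5
    rw [h8] at h7
    have h9 : b / c * Real.exp (-ρ * t) ^ 2 * ‖z 0 - z₀‖ ^ 2 =
        (Real.exp (-ρ * t) ^ 2 * (b * ‖z 0 - z₀‖ ^ 2)) / c := by ring
    rw [h9, le_div_iff₀ hc]
    linarith
  exact (sq_le_sq₀ (norm_nonneg _) (by positivity)).1 h4

/-! ### Nash equilibria and the pseudo-gradient -/

namespace NetworkGame

variable {N : ℕ} {p : Fin N → ℕ}

theorem sum_nbr_mulVec (G : NetworkGame N p) (i : Fin N) (y : ∀ i, Fin (p i) → ℝ) :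
    ∑ j ∈ G.nbr i, G.R i j *ᵥ y j = ∑ j ∈ Finset.univ.erase i, G.R i j *ᵥ y j :=
  Finset.sum_subset (fun j hj => Finset.mem_erase.2
      ⟨fun e => G.self_notMem i (e ▸ hj), Finset.mem_univ j⟩) fun j hj hn => by
    rw [(G.eq_zero_of_notMem i j (Finset.ne_of_mem_erase hj) hn).1, zero_mulVec]

/-- The stacked matrix `R̄` acts as `linGrad`. -/
theorem Rbar_mulVec (G : NetworkGame N p) (y : ∀ i, Fin (p i) → ℝ) :
    G.Rbar *ᵥ (fun k => y k.1 k.2) = fun k => G.linGrad k.1 y k.2 := by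
  ext ⟨i, a⟩
  rw [linGrad, sum_nbr_mulVec]
  have h1 : (G.Rbar *ᵥ (fun k => y k.1 k.2)) ⟨i, a⟩ =
      ∑ j, ((G.R i j *ᵥ y j) a + if i = j then ((G.R j i)ᵀ *ᵥ y j) a else 0) := by
    simp only [mulVec, dotProduct, Fintype.sum_sigma]
    refine Finset.sum_congr rfl fun j _ => ?_
    by_cases h : i = j
    · simp [Rbar, h, add_mul, Finset.sum_add_distrib]
    · simp [Rbar, h]
  rw [h1, Finset.sum_add_distrib, Finset.sum_ite_eq, if_pos (Finset.mem_univ i),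
    ← Finset.add_sum_erase _ _ (Finset.mem_univ i), add_mulVec]
  simp only [Pi.add_apply, Finset.sum_apply]
  ring

/-- The linear map `y ↦ (linGrad i y)_i`. -/
noncomputable def linGradMap (G : NetworkGame N p) :
    (∀ i, Fin (p i) → ℝ) →ₗ[ℝ] (∀ i, Fin (p i) → ℝ) where
  toFun y i := G.linGrad i y
  map_add' x y := by
    ext1 i
    simp only [linGrad, Pi.add_apply, mulVec_add, Finset.sum_add_distrib]
    abel
  map_smul' c y := by
    ext1 i
    simp only [linGrad, Pi.smul_apply, mulVec_smul, ← Finset.smul_sum, ← smul_add,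
      RingHom.id_apply]

theorem linGradMap_apply (G : NetworkGame N p) (y : ∀ i, Fin (p i) → ℝ) (i : Fin N) :
    G.linGradMap y i = G.linGrad i y := rfl

/-- The standard dot product on the joint decision space. -/
noncomputable def jointDot (p : Fin N → ℕ) : LinearMap.BilinForm ℝ (∀ i, Fin (p i) → ℝ) :=
  piForm fun i => dotForm (Fin (p i))

theorem jointDot_apply (u v : ∀ i, Fin (p i) → ℝ) : jointDot p u v = ∑ i, u i ⬝ᵥ v i := by
  rw [jointDot, piForm_apply]; rfl

theorem IsMonotone.jointDot_linGradMap_pos {G : NetworkGame N p} (hG : G.IsMonotone)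
    (y : ∀ i, Fin (p i) → ℝ) (hy : y ≠ 0) : 0 < jointDot p (G.linGradMap y) y := by
  have h1 := hG (fun k => y k.1 k.2) fun h => hy (by
    ext i a; exact congrFun h ⟨i, a⟩)
  rw [Rbar_mulVec] at h1
  have h2 : jointDot p (G.linGradMap y) y =
      (fun k : Σ i, Fin (p i) => y k.1 k.2) ⬝ᵥ (fun k => G.linGrad k.1 y k.2) := by
    rw [jointDot_apply, dotProduct, Fintype.sum_sigma]
    exact Finset.sum_congr rfl fun i _ => dotProduct_comm _ _
  rwa [h2]

/-- Positive definiteness of `Rbar` is exactly the decrease of the dot product along the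
pseudo-gradient flow. It yields injectivity of Γ here and stability of the slow integrator dynamics
later. -/
theorem IsMonotone.isLyapunovForm {G : NetworkGame N p} (hG : G.IsMonotone) :
    IsLyapunovForm (jointDot p) (-G.linGradMap) := by
  refine ⟨fun u v => ?_, piForm_pos _ fun i v hv => dotProduct_self_pos_of_ne_zero hv,
    fun v hv => ?_⟩
  · rw [jointDot_apply, jointDot_apply]
    exact Finset.sum_congr rfl fun i _ => dotProduct_comm _ _
  · simpa using hG.jointDot_linGradMap_pos v hv

/-- Exact second order expansion of the cost in the agent's own decision. -/
theorem cost_update (G : NetworkGame N p) (i : Fin N) (y : ∀ i, Fin (p i) → ℝ)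
    (h : Fin (p i) → ℝ) :
    G.cost i (Function.update y i (y i + h)) =
      G.cost i y + G.partialGrad i y ⬝ᵥ h + h ⬝ᵥ (G.R i i *ᵥ h) := by
  have h1 : ∑ j ∈ Finset.univ.erase i,
        ((y i + h) ⬝ᵥ (G.R i j *ᵥ Function.update y i (y i + h) j)
          + Function.update y i (y i + h) j ⬝ᵥ (G.Q i j *ᵥ Function.update y i (y i + h) j)) =
      ∑ j ∈ Finset.univ.erase i, (y i ⬝ᵥ (G.R i j *ᵥ y j) + y j ⬝ᵥ (G.Q i j *ᵥ y j))
        + ∑ j ∈ Finset.univ.erase i, h ⬝ᵥ (G.R i j *ᵥ y j) := by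
    rw [← Finset.sum_add_distrib]
    refine Finset.sum_congr rfl fun j hj => ?_
    rw [Function.update_of_ne (Finset.ne_of_mem_erase hj), add_dotProduct]
    ring
  have h2 : G.partialGrad i y ⬝ᵥ h = h ⬝ᵥ (G.R i i *ᵥ y i) + y i ⬝ᵥ (G.R i i *ᵥ h)
      + (∑ j ∈ Finset.univ.erase i, h ⬝ᵥ (G.R i j *ᵥ y j)) + G.b i ⬝ᵥ h := by
    unfold partialGrad linGrad
    rw [sum_nbr_mulVec, add_dotProduct, dotProduct_comm _ h, dotProduct_add, dotProduct_sum,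
      add_mulVec, dotProduct_add, mulVec_transpose, dotProduct_comm h (y i ᵥ* _),
      dotProduct_mulVec (y i)]
  rw [h2]
  simp only [cost, Function.update_self, h1]
  simp only [mulVec_add, add_dotProduct, dotProduct_add]
  ring

/-- Nash equilibria are the zeros of the pseudo-gradient. -/
theorem isNE_iff (G : NetworkGame N p) (y : ∀ i, Fin (p i) → ℝ) :
    G.IsNE y ↔ ∀ i, G.partialGrad i y = 0 := by
  constructor
  · intro h i
    -- Varying the decision along the gradient itself, the derivative at the minimum is its squared
    -- length.
    have h1 := G.hasDerivAt_cost i y (G.partialGrad i y)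
    have h2 : IsLocalMin (fun t : ℝ => G.cost i
        (Function.update y i (y i + t • G.partialGrad i y))) 0 :=
      Eventually.of_forall fun t => by simpa using h i _
    exact dotProduct_self_eq_zero.1 (h2.hasDerivAt_eq_zero h1)
  · intro h i v
    have h1 := G.cost_update i y (v - y i)
    rw [h i, zero_dotProduct, add_zero, add_sub_cancel] at h1
    rw [h1]
    rcases eq_or_ne (v - y i) 0 with h0 | h0
    · simp [h0]
    · linarith [G.diag_pos i _ h0]

theorem isNE_iff_linGradMap (G : NetworkGame N p) (y : ∀ i, Fin (p i) → ℝ) :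
    G.IsNE y ↔ G.linGradMap y = -G.b := by
  rw [isNE_iff, funext_iff]
  exact forall_congr' fun i => by
    rw [partialGrad, linGradMap_apply, Pi.neg_apply, add_eq_zero_iff_eq_neg]

theorem IsMonotone.linGradMap_injective {G : NetworkGame N p} (hG : G.IsMonotone) :
    Function.Injective G.linGradMap := by
  have h : HasLyapunovForm (-G.linGradMap) := ⟨_, hG.isLyapunovForm⟩
  intro x y hxy
  exact h.injective (by simp [hxy])

/-- A monotone game has a Nash equilibrium. -/
theorem IsMonotone.exists_isNE {G : NetworkGame N p} (hG : G.IsMonotone) : ∃ y, G.IsNE y := by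
  obtain ⟨y, hy⟩ := LinearMap.injective_iff_surjective.1 hG.linGradMap_injective (-G.b)
  exact ⟨y, (G.isNE_iff_linGradMap y).2 hy⟩

theorem IsMonotone.isNE_unique {G : NetworkGame N p} (hG : G.IsMonotone)
    {y y' : ∀ i, Fin (p i) → ℝ} (h : G.IsNE y) (h' : G.IsNE y') : y = y' :=
  hG.linGradMap_injective
    (((G.isNE_iff_linGradMap y).1 h).trans ((G.isNE_iff_linGradMap y').1 h').symm)

theorem IsNE.Rbar_mulVec_add_Qbar {G : NetworkGame N p} {y : ∀ i, Fin (p i) → ℝ}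
    (h : G.IsNE y) : G.Rbar *ᵥ (fun k => y k.1 k.2) + G.Qbar = 0 := by
  rw [Rbar_mulVec]
  ext k
  exact congrFun ((G.isNE_iff y).1 h k.1) k.2

end NetworkGame

/-! ### Regulator equations and observer gains -/

/-- The block diagonal linear map with blocks `M i`. -/
noncomputable def blockMap {ι : Type*} {a b : ι → ℕ}
    (M : ∀ i, Matrix (Fin (a i)) (Fin (b i)) ℝ) :
    (∀ i, Fin (b i) → ℝ) →ₗ[ℝ] (∀ i, Fin (a i) → ℝ) :=
  LinearMap.pi fun i => (M i).mulVecLin ∘ₗ LinearMap.proj i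

theorem blockMap_apply {ι : Type*} {a b : ι → ℕ} (M : ∀ i, Matrix (Fin (a i)) (Fin (b i)) ℝ)
    (v : ∀ i, Fin (b i) → ℝ) (i : ι) : blockMap M v i = M i *ᵥ v i := rfl

/-- The rank condition yields a solution of the regulator equations `A Π + B Γ = 0`, `C Π = 1`. -/
theorem exists_regulator_of_rank {n m p : ℕ} (A : Matrix (Fin n) (Fin n) ℝ)
    (B : Matrix (Fin n) (Fin m) ℝ) (C : Matrix (Fin p) (Fin n) ℝ)
    (h : (Matrix.fromBlocks A B C 0 : Matrix (Fin n ⊕ Fin p) (Fin n ⊕ Fin m) ℝ).rank = n + p) :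
    ∃ (X : Matrix (Fin n) (Fin p) ℝ) (Y : Matrix (Fin m) (Fin p) ℝ),
      A * X + B * Y = 0 ∧ C * X = 1 := by
  set M : Matrix (Fin n ⊕ Fin p) (Fin n ⊕ Fin m) ℝ := Matrix.fromBlocks A B C 0 with hM
  have hsurj : Function.Surjective M.mulVecLin := by
    rw [← LinearMap.range_eq_top]
    apply Submodule.eq_top_of_finrank_eq
    rw [Matrix.rank] at h
    rw [h]
    simp
  obtain ⟨g, hg⟩ := M.mulVecLin.exists_rightInverse_of_surjective (LinearMap.range_eq_top.2 hsurj)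
  have h1 : M * LinearMap.toMatrix' g = 1 := by
    have := congrArg LinearMap.toMatrix' hg
    rwa [LinearMap.toMatrix'_comp, LinearMap.toMatrix'_id, ← Matrix.toLin'_apply',
      LinearMap.toMatrix'_toLin'] at this
  rw [← Matrix.fromBlocks_toBlocks (LinearMap.toMatrix' g), hM, Matrix.fromBlocks_multiply,
    ← Matrix.fromBlocks_one, Matrix.fromBlocks_inj] at h1
  -- X and Y form the second block column of the right inverse.
  exact ⟨_, _, h1.2.1, by simpa using h1.2.2.2⟩

/-- Detectability yields a quadratic form that decreases along `A` up to an output term, and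
a gain which is adjoint to the output map for this form. -/
theorem IsDetectable.exists_form {n p : ℕ} {A : Matrix (Fin n) (Fin n) ℝ}
    {C : Matrix (Fin p) (Fin n) ℝ} (h : IsDetectable A C) :
    ∃ (P : LinearMap.BilinForm ℝ (Fin n → ℝ)) (D : Matrix (Fin n) (Fin p) ℝ) (a b : ℝ),
      (∀ u v, P u v = P v u) ∧ (∀ v, v ≠ 0 → 0 < P v v) ∧ 0 < a ∧ 0 ≤ b ∧
      (∀ v, P (A *ᵥ v) v ≤ -(a * ‖v‖ ^ 2) + b * ‖C *ᵥ v‖ ^ 2) ∧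
      ∀ y v, P (D *ᵥ y) v = y ⬝ᵥ (C *ᵥ v) := by
  obtain ⟨L, hL⟩ := h
  obtain ⟨P, hP⟩ := hL.hasLyapunovForm
  obtain ⟨a, ha, h1⟩ := hP.exists_apply_le
  obtain ⟨b, hb, h2⟩ := exists_abs_le_mul_norm (P ∘ₗ L.mulVecLin)
  have hinj : Function.Injective P := by
    rw [← LinearMap.ker_eq_bot, LinearMap.ker_eq_bot']
    intro v hv
    by_contra hv0
    simpa [hv] using hP.2.1 v hv0
  let e := P.linearEquivOfInjective hinj Subspace.dual_finrank_eq.symm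
  -- In matrix terms this is P⁻¹Cᵀ.
  let d : (Fin p → ℝ) →ₗ[ℝ] (Fin n → ℝ) :=
    e.symm.toLinearMap ∘ₗ (dotForm (Fin p)).compl₂ C.mulVecLin
  have hd : ∀ y v, P (d y) v = y ⬝ᵥ (C *ᵥ v) := fun y v => by
    change e (e.symm ((dotForm (Fin p)).compl₂ C.mulVecLin y)) v = _
    rw [LinearEquiv.apply_symm_apply]
    rfl
  refine ⟨P, LinearMap.toMatrix' d, a / 2, b ^ 2 / (2 * a), hP.1, hP.2.1, by positivity,
    by positivity, fun v => ?_, fun y v => ?_⟩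
  · have h3 := h1 v
    have h4 := (abs_le.1 (h2 (C *ᵥ v) v)).2
    simp only [mulVecLin_apply, LinearMap.comp_apply, map_sub, LinearMap.sub_apply,
      ← mulVec_mulVec] at h3 h4
    have h5 : b * ‖C *ᵥ v‖ * ‖v‖ = a / 2 * ‖v‖ ^ 2 + b ^ 2 / (2 * a) * ‖C *ᵥ v‖ ^ 2
        - (a * ‖v‖ - b * ‖C *ᵥ v‖) ^ 2 / (2 * a) := by
      field_simp; ring
    have h6 : 0 ≤ (a * ‖v‖ - b * ‖C *ᵥ v‖) ^ 2 / (2 * a) := by positivity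
    linarith
  · rw [LinearMap.toMatrix'_mulVec, hd]

theorem NetworkGame.linGrad_of_eq_zero {N : ℕ} {p : Fin N → ℕ} (G : NetworkGame N p) (i : Fin N)
    (y : ∀ i, Fin (p i) → ℝ) (hy : ∀ j, j ≠ i → y j = 0) :
    G.linGrad i y = (G.R i i + (G.R i i)ᵀ) *ᵥ y i := by
  rw [NetworkGame.linGrad, Finset.sum_eq_zero, add_zero]
  intro j hj
  rw [hy j (fun e => G.self_notMem i (e ▸ hj)), mulVec_zero]

section Design

open NetworkGame

variable {N : ℕ} {n m p : Fin N → ℕ}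

/-- The linear dynamics of the joint observation error. -/
noncomputable def observerMap (A : ∀ i, Matrix (Fin (n i)) (Fin (n i)) ℝ)
    (C : ∀ i, Matrix (Fin (p i)) (Fin (n i)) ℝ) (G : NetworkGame N p)
    (L : ∀ i, Matrix (Fin (n i)) (Fin (p i)) ℝ) :
    (∀ i, Fin (n i) → ℝ) →ₗ[ℝ] (∀ i, Fin (n i) → ℝ) :=
  blockMap A - blockMap L ∘ₗ G.linGradMap ∘ₗ blockMap C

/-- Distributed observers that only use the gradient of a monotone game: local gains exist that
stabilize every local error and the joint error. -/
theorem exists_observer_gain (A : ∀ i, Matrix (Fin (n i)) (Fin (n i)) ℝ)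
    (C : ∀ i, Matrix (Fin (p i)) (Fin (n i)) ℝ) {G : NetworkGame N p} (hG : G.IsMonotone)
    (hdet : ∀ i, IsDetectable (A i) (C i)) :
    ∃ L : ∀ i, Matrix (Fin (n i)) (Fin (p i)) ℝ,
      (∀ i, IsHurwitz (A i - L i * (G.R i i + (G.R i i)ᵀ) * C i)) ∧
      HasLyapunovForm (observerMap A C G L) := by
  choose P D a b hs hp ha hb hA hD using fun i => (hdet i).exists_form
  obtain ⟨s, hs0, hsG⟩ := exists_mul_norm_sq_le_of_pos (jointDot p ∘ₗ G.linGradMap)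
    fun v hv => hG.jointDot_linGradMap_pos v hv
  -- In the sup norm each ‖C_i v_i‖ is at most ‖y‖, so the surplus is at most (∑ b_i)‖y‖², which
  -- τs‖y‖² cancels.
  set τ : ℝ := (∑ i, b i) / s with hτ
  have hτ0 : 0 ≤ τ := div_nonneg (Finset.sum_nonneg fun i _ => hb i) hs0.le
  let L : ∀ i, Matrix (Fin (n i)) (Fin (p i)) ℝ := fun i => τ • D i
  have hneg : ∀ v, v ≠ 0 → piForm P (observerMap A C G L v) v < 0 := by
    intro v hv
    set y := blockMap C v with hy
    -- The adjointness of D_i collapses the sum of local corrections into one pairing of Γy with y.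
    have h1 : piForm P (observerMap A C G L v) v =
        ∑ i, P i (A i *ᵥ v i) (v i) - τ * jointDot p (G.linGradMap y) y := by
      rw [piForm_apply, jointDot_apply, Finset.mul_sum, ← Finset.sum_sub_distrib]
      refine Finset.sum_congr rfl fun i _ => ?_
      have h2 : observerMap A C G L v i = A i *ᵥ v i - τ • (D i *ᵥ G.linGradMap y i) := by
        rw [← smul_mulVec]; rfl
      rw [h2, map_sub, LinearMap.sub_apply, map_smul, LinearMap.smul_apply, hD, smul_eq_mul]
      rfl
    have h2 : ∑ i, P i (A i *ᵥ v i) (v i) ≤ -(∑ i, a i * ‖v i‖ ^ 2) + (∑ i, b i) * ‖y‖ ^ 2 := by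
      rw [Finset.sum_mul, ← Finset.sum_neg_distrib, ← Finset.sum_add_distrib]
      refine Finset.sum_le_sum fun i _ => (hA i (v i)).trans ?_
      have h3 : ‖C i *ᵥ v i‖ ≤ ‖y‖ := norm_le_pi_norm y i
      have h4 : ‖C i *ᵥ v i‖ ^ 2 ≤ ‖y‖ ^ 2 := by gcongr
      linarith [mul_le_mul_of_nonneg_left h4 (hb i)]
    have h3 := mul_le_mul_of_nonneg_left (hsG y) hτ0
    have h4 : τ * (s * ‖y‖ ^ 2) = (∑ i, b i) * ‖y‖ ^ 2 := by
      rw [hτ]; field_simp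
    have h5 : 0 < ∑ i, a i * ‖v i‖ ^ 2 := by
      obtain ⟨i, hi⟩ := Function.ne_iff.1 hv
      have := norm_pos_iff.2 hi
      exact Finset.sum_pos' (fun j _ => mul_nonneg (ha j).le (sq_nonneg _))
        ⟨i, Finset.mem_univ i, mul_pos (ha i) (pow_pos this 2)⟩
    simp only [LinearMap.comp_apply] at h3
    linarith
  have hsymm : ∀ u v, piForm P u v = piForm P v u := fun u v => by
    rw [piForm_apply, piForm_apply]
    exact Finset.sum_congr rfl fun i _ => hs i _ _
  refine ⟨L, fun i => HasLyapunovForm.isHurwitz ⟨P i, hs i, hp i, fun w hw => ?_⟩,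
    piForm P, hsymm, piForm_pos P hp, hneg⟩
  -- On vectors supported in block i, the joint decrease becomes the Lyapunov inequality of the
  -- local error matrix.
  have h1 := hneg (Pi.single i w) (by simpa using hw)
  rw [piForm_apply, Finset.sum_eq_single i (fun j _ hj => by simp [Pi.single_eq_of_ne hj])
    (fun h => absurd (Finset.mem_univ i) h), Pi.single_eq_same] at h1
  have h2 : observerMap A C G L (Pi.single i w) i =
      (A i - L i * (G.R i i + (G.R i i)ᵀ) * C i) *ᵥ w := by
    have h3 : observerMap A C G L (Pi.single i w) i = blockMap A (Pi.single i w) i -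
        L i *ᵥ G.linGrad i (blockMap C (Pi.single i w)) := rfl
    rw [h3, G.linGrad_of_eq_zero i _ fun j hj => by
      rw [blockMap_apply, Pi.single_eq_of_ne hj, mulVec_zero], blockMap_apply, blockMap_apply,
      Pi.single_eq_same,      sub_mulVec, ← mulVec_mulVec, ← mulVec_mulVec]
  rwa [h2] at h1

end Design

/-! ### Integral action -/

/-- Low-gain integral action: if `f` has a Lyapunov form, `f x = g` at the steady state map `x`,
and the steady state output map `r` is such that `-r` has a Lyapunov form, then feeding back the
integral of the output with a small gain preserves stability. -/
theorem HasLyapunovForm.exists_integral_action {E F : Type*} [NormedAddCommGroup E]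
    [NormedSpace ℝ E] [FiniteDimensional ℝ E] [NormedAddCommGroup F] [NormedSpace ℝ F]
    [FiniteDimensional ℝ F] {f : E →ₗ[ℝ] E} {h : E →ₗ[ℝ] F} {g x : F →ₗ[ℝ] E} {r : F →ₗ[ℝ] F}
    (hf : HasLyapunovForm f) (hx : f ∘ₗ x = g) (hr : h ∘ₗ x = r) (hneg : HasLyapunovForm (-r)) :
    ∃ ε : ℝ, 0 < ε ∧
      HasLyapunovForm ((f.coprod (ε • g)).prod (h ∘ₗ LinearMap.fst ℝ E F)) := by
  let fe := LinearEquiv.ofInjectiveEndo f hf.injective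
  -- j = h f⁻¹. In the coordinate w - ju the fast input hu cancels, leaving the derivative -εrw =
  -- -εr(w - ju) - εrju.
  let j : E →ₗ[ℝ] F := h ∘ₗ fe.symm.toLinearMap
  have hjf : ∀ v, j (f v) = h v := fun v => by
    change h (fe.symm (fe v)) = h v
    rw [LinearEquiv.symm_apply_apply]
  have hjg : ∀ v, j (g v) = r v := fun v => by
    rw [← hx, ← hr]
    exact hjf _
  obtain ⟨ε, hε, hL⟩ := hf.exists_slow_fast hneg g (g ∘ₗ j) (r ∘ₗ j)
  refine ⟨ε, hε, hL.of_conj ((LinearEquiv.refl ℝ E).skewProd (LinearEquiv.refl ℝ F) (-j)) _ ?_⟩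
  rintro ⟨u, w⟩
  refine Prod.ext ?_ ?_
  · simp
    abel
  · simp [hjf, hjg]

/-! ### Linear part of the closed loop and feedback gains -/

section LinearPart

variable {N : ℕ} {n m p : Fin N → ℕ}

/-- The control inputs as a linear map of the closed-loop state. -/
noncomputable def controlMap (K₁ : ∀ i, Matrix (Fin (m i)) (Fin (n i)) ℝ)
    (K₂ : ∀ i, Matrix (Fin (m i)) (Fin (p i)) ℝ) :
    ClosedLoopState N n p →ₗ[ℝ] (∀ i, Fin (m i) → ℝ) :=
  (blockMap K₁).coprod (blockMap K₂) ∘ₗ LinearMap.snd ℝ _ _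

/-- The linear part of the closed loop. -/
noncomputable def closedLoopMap (A : ∀ i, Matrix (Fin (n i)) (Fin (n i)) ℝ)
    (B : ∀ i, Matrix (Fin (n i)) (Fin (m i)) ℝ) (C : ∀ i, Matrix (Fin (p i)) (Fin (n i)) ℝ)
    (G : NetworkGame N p) (L : ∀ i, Matrix (Fin (n i)) (Fin (p i)) ℝ)
    (K₁ : ∀ i, Matrix (Fin (m i)) (Fin (n i)) ℝ) (K₂ : ∀ i, Matrix (Fin (m i)) (Fin (p i)) ℝ)
    (μ : Uncertainty N n m p) : ClosedLoopState N n p →ₗ[ℝ] ClosedLoopState N n p :=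
  (blockMap (A + μ.1) ∘ₗ LinearMap.fst ℝ _ _ + blockMap (B + μ.2.1) ∘ₗ controlMap K₁ K₂).prod
    ((blockMap A ∘ₗ LinearMap.fst ℝ _ _ ∘ₗ LinearMap.snd ℝ _ _ + blockMap B ∘ₗ controlMap K₁ K₂
        - blockMap L ∘ₗ (G.linGradMap ∘ₗ blockMap C ∘ₗ LinearMap.fst ℝ _ _ ∘ₗ LinearMap.snd ℝ _ _
          - G.linGradMap ∘ₗ blockMap (C + μ.2.2) ∘ₗ LinearMap.fst ℝ _ _)).prod
      (G.linGradMap ∘ₗ blockMap (C + μ.2.2) ∘ₗ LinearMap.fst ℝ _ _))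

/-- The offset b enters only through e_i, so the constant term does not depend on μ. -/
theorem closedLoop_eq (A : ∀ i, Matrix (Fin (n i)) (Fin (n i)) ℝ)
    (B : ∀ i, Matrix (Fin (n i)) (Fin (m i)) ℝ) (C : ∀ i, Matrix (Fin (p i)) (Fin (n i)) ℝ)
    (G : NetworkGame N p) (L : ∀ i, Matrix (Fin (n i)) (Fin (p i)) ℝ)
    (K₁ : ∀ i, Matrix (Fin (m i)) (Fin (n i)) ℝ) (K₂ : ∀ i, Matrix (Fin (m i)) (Fin (p i)) ℝ)
    (μ : Uncertainty N n m p) (z : ClosedLoopState N n p) :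
    closedLoop A B C G L K₁ K₂ μ z =
      closedLoopMap A B C G L K₁ K₂ μ z + (0, blockMap L G.b, G.b) := by
  refine Prod.ext ?_ (Prod.ext ?_ ?_)
  · rw [Prod.fst_add, add_zero]
    rfl
  · ext1 i
    have h1 : (closedLoopMap A B C G L K₁ K₂ μ z).2.1 i = A i *ᵥ z.2.1 i +
        B i *ᵥ controlInput K₁ K₂ z i - L i *ᵥ (G.linGrad i (fun j => C j *ᵥ z.2.1 j) -
          G.linGrad i (plantOutput C μ z)) := rfl
    rw [Prod.snd_add, Prod.fst_add, Pi.add_apply, h1]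
    simp only [closedLoop, NetworkGame.partialGrad, blockMap_apply, mulVec_sub, mulVec_add]
    abel
  · rfl

theorem continuous_blockMap {a b : Fin N → ℕ} :
    Continuous fun z : (∀ i, Matrix (Fin (a i)) (Fin (b i)) ℝ) × (∀ i, Fin (b i) → ℝ) =>
      blockMap z.1 z.2 :=
  continuous_pi fun i => by
    simp only [blockMap_apply]
    exact Continuous.matrix_mulVec (by fun_prop) (by fun_prop)

theorem continuous_closedLoopMap (A : ∀ i, Matrix (Fin (n i)) (Fin (n i)) ℝ)
    (B : ∀ i, Matrix (Fin (n i)) (Fin (m i)) ℝ) (C : ∀ i, Matrix (Fin (p i)) (Fin (n i)) ℝ)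
    (G : NetworkGame N p) (L : ∀ i, Matrix (Fin (n i)) (Fin (p i)) ℝ)
    (K₁ : ∀ i, Matrix (Fin (m i)) (Fin (n i)) ℝ) (K₂ : ∀ i, Matrix (Fin (m i)) (Fin (p i)) ℝ) :
    Continuous fun w : Uncertainty N n m p × ClosedLoopState N n p =>
      closedLoopMap A B C G L K₁ K₂ w.1 w.2 := by
  have hu : Continuous (controlMap (n := n) K₁ K₂) := LinearMap.continuous_of_finiteDimensional _
  have hg : Continuous G.linGradMap := LinearMap.continuous_of_finiteDimensional _
  have hA : Continuous (blockMap A) := LinearMap.continuous_of_finiteDimensional _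
  have hB : Continuous (blockMap B) := LinearMap.continuous_of_finiteDimensional _
  have hC : Continuous (blockMap C) := LinearMap.continuous_of_finiteDimensional _
  have hL : Continuous (blockMap L) := LinearMap.continuous_of_finiteDimensional _
  have h1 : Continuous fun w : Uncertainty N n m p × ClosedLoopState N n p =>
      blockMap (A + w.1.1) w.2.1 :=
    continuous_blockMap.comp (f := fun w : Uncertainty N n m p × ClosedLoopState N n p =>
      (A + w.1.1, w.2.1)) (by fun_prop)
  have h2 : Continuous fun w : Uncertainty N n m p × ClosedLoopState N n p =>
      blockMap (B + w.1.2.1) (controlMap K₁ K₂ w.2) :=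
    continuous_blockMap.comp (f := fun w : Uncertainty N n m p × ClosedLoopState N n p =>
      (B + w.1.2.1, controlMap K₁ K₂ w.2)) (by fun_prop)
  have h3 : Continuous fun w : Uncertainty N n m p × ClosedLoopState N n p =>
      blockMap (C + w.1.2.2) w.2.1 :=
    continuous_blockMap.comp (f := fun w : Uncertainty N n m p × ClosedLoopState N n p =>
      (C + w.1.2.2, w.2.1)) (by fun_prop)
  change Continuous fun w : Uncertainty N n m p × ClosedLoopState N n p =>
    ((blockMap (A + w.1.1) w.2.1 + blockMap (B + w.1.2.1) (controlMap K₁ K₂ w.2),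
      blockMap A w.2.2.1 + blockMap B (controlMap K₁ K₂ w.2) -
        blockMap L (G.linGradMap (blockMap C w.2.2.1) -
          G.linGradMap (blockMap (C + w.1.2.2) w.2.1)),
      G.linGradMap (blockMap (C + w.1.2.2) w.2.1)) : ClosedLoopState N n p)
  fun_prop

/-- Coordinates in which the nominal closed loop is a cascade: observer, integrator, and
observation error. -/
def errorCoordinates (N : ℕ) (n p : Fin N → ℕ) :
    ClosedLoopState N n p ≃ₗ[ℝ]
      ((∀ i, Fin (n i) → ℝ) × (∀ i, Fin (p i) → ℝ)) × (∀ i, Fin (n i) → ℝ) where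
  toFun z := ((z.2.1, z.2.2), z.2.1 - z.1)
  invFun w := (w.1.1 - w.2, w.1.1, w.1.2)
  map_add' z w := by
    refine Prod.ext rfl ?_
    change z.2.1 + w.2.1 - (z.1 + w.1) = z.2.1 - z.1 + (w.2.1 - w.1)
    abel
  map_smul' c z := Prod.ext rfl (smul_sub c z.2.1 z.1).symm
  left_inv z := Prod.ext (sub_sub_cancel _ _) rfl
  right_inv w := Prod.ext rfl (sub_sub_cancel _ _)

/-- Separation principle: the nominal closed loop has a Lyapunov form if the observer error and
the state feedback loop with integral action do. -/
theorem hasLyapunovForm_closedLoopMap_zero (A : ∀ i, Matrix (Fin (n i)) (Fin (n i)) ℝ)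
    (B : ∀ i, Matrix (Fin (n i)) (Fin (m i)) ℝ) (C : ∀ i, Matrix (Fin (p i)) (Fin (n i)) ℝ)
    (G : NetworkGame N p) (L : ∀ i, Matrix (Fin (n i)) (Fin (p i)) ℝ)
    (K₁ : ∀ i, Matrix (Fin (m i)) (Fin (n i)) ℝ) (K₂ : ∀ i, Matrix (Fin (m i)) (Fin (p i)) ℝ)
    (hobs : HasLyapunovForm (observerMap A C G L))
    (hfb : HasLyapunovForm (((blockMap A + blockMap B ∘ₗ blockMap K₁).coprod
      (blockMap B ∘ₗ blockMap K₂)).prod ((G.linGradMap ∘ₗ blockMap C) ∘ₗ LinearMap.fst ℝ _ _))) :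
    HasLyapunovForm (closedLoopMap A B C G L K₁ K₂ 0) := by
  -- With η = ξ - x, the error obeys η̇ = (A - LΓC)η on its own, and drives ξ through -LΓCη and ζ
  -- through -ΓCη.
  refine (hfb.cascade hobs ((-(blockMap L ∘ₗ G.linGradMap ∘ₗ blockMap C)).prod
    (-(G.linGradMap ∘ₗ blockMap C)))).of_conj (errorCoordinates N n p) _ ?_
  rintro ⟨x, ξ, ζ⟩
  refine Prod.ext (Prod.ext ?_ ?_) ?_
  · simp [errorCoordinates, closedLoopMap, controlMap]
    abel
  · simp [errorCoordinates, closedLoopMap]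
  · simp [errorCoordinates, closedLoopMap, controlMap, observerMap]
    abel

/-- Existence of stabilizing local state feedback with integral action. -/
theorem exists_feedback_gain (A : ∀ i, Matrix (Fin (n i)) (Fin (n i)) ℝ)
    (B : ∀ i, Matrix (Fin (n i)) (Fin (m i)) ℝ) (C : ∀ i, Matrix (Fin (p i)) (Fin (n i)) ℝ)
    {G : NetworkGame N p} (hG : G.IsMonotone) (hstab : ∀ i, IsStabilizable (A i) (B i))
    (hrank : ∀ i, (Matrix.fromBlocks (A i) (B i) (C i) 0 :
      Matrix (Fin (n i) ⊕ Fin (p i)) (Fin (n i) ⊕ Fin (m i)) ℝ).rank = n i + p i) :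
    ∃ (K₁ : ∀ i, Matrix (Fin (m i)) (Fin (n i)) ℝ) (K₂ : ∀ i, Matrix (Fin (m i)) (Fin (p i)) ℝ),
      HasLyapunovForm (((blockMap A + blockMap B ∘ₗ blockMap K₁).coprod
        (blockMap B ∘ₗ blockMap K₂)).prod
          ((G.linGradMap ∘ₗ blockMap C) ∘ₗ LinearMap.fst ℝ _ _)) := by
  choose K₁ hK using hstab
  choose X Y hXY hCX using fun i => exists_regulator_of_rank _ _ _ (hrank i)
  -- Chosen so that (A + BK₁)X = BK, using AX = -BY.
  let K : ∀ i, Matrix (Fin (m i)) (Fin (p i)) ℝ := fun i => K₁ i * X i - Y i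
  have hf : HasLyapunovForm (blockMap A + blockMap B ∘ₗ blockMap K₁) := by
    have h1 := HasLyapunovForm.pi fun i => (hK i).hasLyapunovForm
    convert h1 using 1
    refine LinearMap.ext fun v => funext fun i => ?_
    change A i *ᵥ v i + B i *ᵥ (K₁ i *ᵥ v i) = (A i + B i * K₁ i) *ᵥ v i
    rw [add_mulVec, mulVec_mulVec]
  have hx : (blockMap A + blockMap B ∘ₗ blockMap K₁) ∘ₗ blockMap X = blockMap B ∘ₗ blockMap K := by
    refine LinearMap.ext fun v => funext fun i => ?_
    change A i *ᵥ (X i *ᵥ v i) + B i *ᵥ (K₁ i *ᵥ (X i *ᵥ v i)) =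
      B i *ᵥ ((K₁ i * X i - Y i) *ᵥ v i)
    rw [sub_mulVec, mulVec_sub, ← mulVec_mulVec, mulVec_mulVec, mulVec_mulVec _ (B i) (Y i),
      eq_sub_iff_add_eq, add_right_comm, ← add_mulVec, hXY, zero_mulVec, zero_add]
  have hr : (G.linGradMap ∘ₗ blockMap C) ∘ₗ blockMap X = G.linGradMap := by
    refine LinearMap.ext fun v => congrArg G.linGradMap (funext fun i => ?_)
    change C i *ᵥ (X i *ᵥ v i) = v i
    rw [mulVec_mulVec, hCX, one_mulVec]
  obtain ⟨ε, -, h⟩ := hf.exists_integral_action hx hr ⟨_, hG.isLyapunovForm⟩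
  refine ⟨K₁, fun i => ε • K i, ?_⟩
  have hε : blockMap B ∘ₗ blockMap (fun i => ε • K i) = ε • (blockMap B ∘ₗ blockMap K) := by
    refine LinearMap.ext fun v => funext fun i => ?_
    change B i *ᵥ ((ε • K i) *ᵥ v i) = ε • (B i *ᵥ (K i *ᵥ v i))
    rw [smul_mulVec, mulVec_smul]
  rwa [hε]

end LinearPart

/-! ### Main theorem -/

theorem corollary2 (N : ℕ) (n m p : Fin N → ℕ)
    (A : ∀ i, Matrix (Fin (n i)) (Fin (n i)) ℝ)
    (B : ∀ i, Matrix (Fin (n i)) (Fin (m i)) ℝ)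
    (C : ∀ i, Matrix (Fin (p i)) (Fin (n i)) ℝ)
    (G : NetworkGame N p) (hG : G.IsMonotone)
    (hstab : ∀ i, IsStabilizable (A i) (B i))
    (hdet : ∀ i, IsDetectable (A i) (C i))
    (hrank : ∀ i, (Matrix.fromBlocks (A i) (B i) (C i) 0 :
      Matrix (Fin (n i) ⊕ Fin (p i)) (Fin (n i) ⊕ Fin (m i)) ℝ).rank = n i + p i) :
    ∃ ystar : ∀ i, Fin (p i) → ℝ,
      G.IsNE ystar ∧ (∀ y, G.IsNE y → y = ystar) ∧
      G.Rbar *ᵥ (fun k => ystar k.1 k.2) + G.Qbar = 0 ∧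
      ∃ (L : ∀ i, Matrix (Fin (n i)) (Fin (p i)) ℝ)
        (K₁ : ∀ i, Matrix (Fin (m i)) (Fin (n i)) ℝ)
        (K₂ : ∀ i, Matrix (Fin (m i)) (Fin (p i)) ℝ),
        (∀ i, IsHurwitz (A i - L i * (G.R i i + (G.R i i)ᵀ) * C i)) ∧
        ∃ W : Set (Uncertainty N n m p), IsOpen W ∧ 0 ∈ W ∧ ∀ μ ∈ W,
          (∃ zeq : ClosedLoopState N n p,
            IsGloballyExpStable (closedLoop A B C G L K₁ K₂ μ) zeq) ∧
          ∀ z : ℝ → ClosedLoopState N n p,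
            IsTrajectory (closedLoop A B C G L K₁ K₂ μ) z →
            Tendsto (fun t => plantOutput C μ (z t)) atTop (𝓝 ystar) := by
  obtain ⟨ystar, hy⟩ := hG.exists_isNE
  obtain ⟨L, hL, hobs⟩ := exists_observer_gain A C hG hdet
  obtain ⟨K₁, K₂, hfb⟩ := exists_feedback_gain A B C hG hstab hrank
  refine ⟨ystar, hy, fun y h => hG.isNE_unique h hy, hy.Rbar_mulVec_add_Qbar, L, K₁, K₂, hL, ?_⟩
  have hrob := HasLyapunovForm.eventually (closedLoopMap A B C G L K₁ K₂)
    (continuous_closedLoopMap A B C G L K₁ K₂)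
    (hasLyapunovForm_closedLoopMap_zero A B C G L K₁ K₂ hobs hfb)
  obtain ⟨W, hW, hWo, hW0⟩ := eventually_nhds_iff.1 hrob
  refine ⟨W, hWo, hW0, fun μ hμ => ?_⟩
  have hT := hW μ hμ
  obtain ⟨zeq, hzeq⟩ := LinearMap.injective_iff_surjective.1 hT.injective
    (-(0, blockMap L G.b, G.b))
  have hstable : IsGloballyExpStable (closedLoop A B C G L K₁ K₂ μ) zeq :=
    hT.isGloballyExpStable _ _ fun z => by
      rw [closedLoop_eq, map_sub, hzeq, sub_neg_eq_add]
  refine ⟨⟨zeq, hstable⟩, fun z hz => ?_⟩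
  -- The integrator component of the equilibrium equation reads Γy + b = 0 for the perturbed output
  -- y, whatever μ is.
  have hout : plantOutput C μ zeq = ystar := by
    refine hG.isNE_unique ((G.isNE_iff_linGradMap _).2 ?_) hy
    exact congrArg (fun w => w.2.2) hzeq
  obtain ⟨-, M, -, ρ, hρ, hbound⟩ := hstable
  have hexp : Tendsto (fun t : ℝ => M * Real.exp (-ρ * t) * ‖z 0 - zeq‖) atTop (𝓝 0) := by
    have h1 : Tendsto (fun t : ℝ => Real.exp (-ρ * t)) atTop (𝓝 0) :=
      Real.tendsto_exp_atBot.comp (tendsto_id.const_mul_atTop_of_neg (neg_lt_zero.2 hρ))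
    simpa using (h1.const_mul M).mul_const ‖z 0 - zeq‖
  have hlim : Tendsto z atTop (𝓝 zeq) := by
    rw [tendsto_iff_norm_sub_tendsto_zero]
    refine squeeze_zero' (Eventually.of_forall fun t => norm_nonneg _) ?_ hexp
    filter_upwards [eventually_ge_atTop 0] with t ht
    exact hbound z hz t ht
  have hcont : Continuous (plantOutput C μ : ClosedLoopState N n p → _) :=
    (LinearMap.continuous_of_finiteDimensional (blockMap (C + μ.2.2))).comp continuous_fst
  rw [← hout]
  exact (hcont.tendsto zeq).comp hlim
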